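/- Call a closed set $K\subset\mathbb{R}^2$ a closed polygonal disk if it is bounded, its boundary is a finite union of straight segments, and it is homeomorphic to the closed unit disk. Let $\Omega_{\rm p}\subset\mathbb{R}^2$ be a regular bounded polytope, that is, $$\Omega_{\rm p} = \mathring{K}_{\rm ext}\setminus \bigcup_{i=1}^N K_{i},$$ where $N\ge 0$, $K_{\rm ext},K_1,\dots,K_N$ are closed polygonal disks, $\mathring{K}_{\rm ext}$ is the interior of $K_{\rm ext}$, and $K_1,\dots,K_N$ are pairwise disjoint and contained in $\mathring{K}_{\rm ext}$. Let $\mathbf{n}$ denote the outward unit normal to $\Omega_{\rm p}$, defined at all points of $\partial\Omega_{\rm p}$ except the vertices. Let $\varphi\in C^1(\overline{\Omega}_{\rm p};\mathbb{R}^2)$, that is, $\varphi$ is continuous on $\overline{\Omega}_{\rm p}$, continuously differentiable in the open set $\Omega_{\rm p}$, and $\nabla\varphi$ extends continuously to $\overline{\Omega}_{\rm p}$; and suppose that $\varphi\cdot\mathbf{n}=0$ on $\partial\Omega_{\rm p}$ wherever $\mathbf{n}$ is defined. Set $\Phi=\mathrm{id}+\varphi$. If the Jacobian determinant $J(\Phi)=\det\nabla\Phi$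 (extended by continuity to $\overline{\Omega}_{\rm p}$) satisfies $\min_{x\in\overline{\Omega}_{\rm p}}J(\Phi)(x)>0$, then $\Phi$ is a bijection of $\Omega_{\rm p}$ onto itself. -/

import Mathlib

open Set Filter Topology

noncomputable section

/-- The Euclidean plane. -/
abbrev Plane : Type := EuclideanSpace ℝ (Fin 2)

/-- A bounded polytope of the plane: a bounded set whose boundary consists of finitely many
straight segments. -/
def IsBoundedPolytope (P : Set Plane) : Prop :=
  Bornology.IsBounded P ∧
    ∃ S : Set (Plane × Plane), S.Finite ∧ frontier P = ⋃ p ∈ S, segment ℝ p.1 p.2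

/-- A closed polygonal disk: a bounded polytope that is homeomorphic to the closed unit ball. -/
def IsPolygonalDisk (K : Set Plane) : Prop :=
  IsBoundedPolytope K ∧ Nonempty (K ≃ₜ Metric.closedBall (0 : Plane) 1)

/-- A regular bounded polytope, as an open set: the open region enclosed by an outer polygonal disk,
from which finitely many (possibly no) pairwise disjoint closed polygonal disks, each of them
contained in that open region (hence compactly embedded in it), are removed. -/
def IsRegularPolytope (Ω : Set Plane) : Prop :=
  ∃ (N : ℕ) (Kext : Set Plane) (Kint : Fin N → Set Plane),
    IsPolygonalDisk Kext ∧
    (∀ i, IsPolygonalDisk (Kint i)) ∧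
    (∀ i, Kint i ⊆ interior Kext) ∧
    (Pairwise fun i j => Disjoint (Kint i) (Kint j)) ∧
    Ω = interior Kext \ ⋃ i, Kint i

/-- `n` is the outward unit normal to the open set `Ω` at `x`: near `x`, the set `Ω` coincides with
the open half-plane through `x` which has outward unit normal `n`. For a regular polytope this
singles out exactly one vector at each boundary point that is not a vertex, and none at a vertex. -/
def IsOutwardNormal (Ω : Set Plane) (x n : Plane) : Prop :=
  ‖n‖ = 1 ∧ ∃ ε > 0, ∀ y ∈ Metric.ball x ε, y ∈ Ω ↔ inner ℝ (y - x) n < 0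

/-- The space of vector fields of class `C¹` up to the boundary of the open set `Ω`: continuous on
the closure, continuously differentiable in `Ω`, and with a gradient that extends continuously to
the closure. -/
def C1Closure (Ω : Set Plane) : Set (Plane → Plane) :=
  {φ | ContinuousOn φ (closure Ω) ∧ ContDiffOn ℝ 1 φ Ω ∧
    ∀ x ∈ closure Ω, ∃ L : Plane →L[ℝ] Plane, Tendsto (fderiv ℝ φ) (𝓝[Ω] x) (𝓝 L)}

/-- The fields of class `C¹` up to the boundary whose normal component vanishes on the boundary. -/
def tangentialC1 (Ω : Set Plane) : Set (Plane → Plane) :=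
  {φ | φ ∈ C1Closure Ω ∧
    ∀ x ∈ frontier Ω, ∀ n : Plane, IsOutwardNormal Ω x n → inner ℝ (φ x) n = 0}

/-- The Jacobian determinant of a map on the closure of `Ω`: the determinant of the gradient,
extended by continuity from `Ω` to the closure. -/
def jacobianDet (Ω : Set Plane) (Φ : Plane → Plane) (x : Plane) : ℝ :=
  (extendFrom Ω (fderiv ℝ Φ) x).det

end

open scoped NNReal

/-! The proof counts preimages. Where two edges with independent normals meet, continuity makes `φ`
orthogonal to both, so `Φ` fixes that point (`IsRegularPolytope.exists_finite_vertices`). Along an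
edge `Φ` stays on the edge line, so in the tangent-normal frame its gradient is triangular and the
Jacobian is the product of the tangential and normal stretches. The tangential stretch thus never
vanishes. As the ends of the edge are fixed, `Φ` permutes the edge increasingly
(`IsSlidingMap.tangent_structure`), and the normal stretch is positive as well. Hence near an edge
`Φ` is a local homeomorphism that keeps the inner side inside
(`IsSlidingMap.exists_homeomorph_of_isOutwardNormal`).

Consequently the number of preimages in `Ω` minus the indicator of `Ω` is locally constant off the
finitely many frontier points without normal: crossing an edge inwards adds exactly one preimage.
The complement of a finite set in the plane is connected and the difference vanishes far away, so it
is zero (`IsSlidingMap.excess_eq_zero`). Openness of `Φ` on `Ω` then handles the exceptional values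
(`IsSlidingMap.bijOn`). -/

/-! ### Linear algebra of the plane -/

theorem Plane.inner_eq (x y : Plane) : inner ℝ x y = x 0 * y 0 + x 1 * y 1 := by
  simp [PiLp.inner_apply, Fin.sum_univ_two, mul_comm]

theorem Plane.ext_coord {x y : Plane} (h0 : x 0 = y 0) (h1 : x 1 = y 1) : x = y := by
  ext i; fin_cases i <;> assumption

theorem Plane.sq_add_sq_of_norm_eq_one {n : Plane} (hn : ‖n‖ = 1) : n 0 ^ 2 + n 1 ^ 2 = 1 := by
  have h := real_inner_self_eq_norm_sq n
  rw [hn, Plane.inner_eq] at h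
  linarith

theorem Plane.norm_eq_one_iff {n : Plane} : ‖n‖ = 1 ↔ n 0 ^ 2 + n 1 ^ 2 = 1 := by
  refine ⟨Plane.sq_add_sq_of_norm_eq_one, fun h => ?_⟩
  have h2 := real_inner_self_eq_norm_sq n
  rw [Plane.inner_eq] at h2
  nlinarith [norm_nonneg n]

/-- The rotation of a vector of the plane by a quarter turn. -/
noncomputable def Plane.rot (n : Plane) : Plane := !₂[-n 1, n 0]

@[simp] theorem Plane.rot_zero (n : Plane) : Plane.rot n 0 = -n 1 := rfl
@[simp] theorem Plane.rot_one (n : Plane) : Plane.rot n 1 = n 0 := rfl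

theorem Plane.norm_rot {n : Plane} (hn : ‖n‖ = 1) : ‖Plane.rot n‖ = 1 := by
  rw [Plane.norm_eq_one_iff] at *
  simp; linarith

theorem Plane.inner_rot (n : Plane) : inner ℝ (Plane.rot n) n = 0 := by
  rw [Plane.inner_eq]; simp; ring

theorem Plane.eq_smul_add_smul_rot {n : Plane} (hn : ‖n‖ = 1) (y : Plane) :
    y = inner ℝ y n • n + inner ℝ y (Plane.rot n) • Plane.rot n := by
  have h := Plane.sq_add_sq_of_norm_eq_one hn
  apply Plane.ext_coord <;> simp [Plane.inner_eq]
  · linear_combination -(y 0) * h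
  · linear_combination -(y 1) * h

theorem Plane.eq_smul_rot {n y : Plane} (hn : ‖n‖ = 1) (hy : inner ℝ y n = 0) :
    y = inner ℝ y (Plane.rot n) • Plane.rot n := by
  conv_lhs => rw [Plane.eq_smul_add_smul_rot hn y, hy, zero_smul, zero_add]

/-- The determinant of two vectors of the plane. -/
noncomputable def Plane.cross (p q : Plane) : ℝ := p 0 * q 1 - p 1 * q 0

theorem Plane.eq_zero_of_cross_ne_zero {p q w : Plane} (h : Plane.cross p q ≠ 0)
    (hp : inner ℝ w p = 0) (hq : inner ℝ w q = 0) : w = 0 := by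
  rw [Plane.inner_eq] at hp hq
  unfold Plane.cross at h
  apply Plane.ext_coord <;> simp <;> apply mul_right_cancel₀ h
  · linear_combination q 1 * hp - p 1 * hq
  · linear_combination -q 0 * hp + p 0 * hq

theorem Plane.inner_eq_zero_of_cross_eq_zero {p q w : Plane} (hq1 : ‖q‖ = 1)
    (h : Plane.cross p q = 0) (hq : inner ℝ w q = 0) : inner ℝ w p = 0 := by
  have h1 := Plane.sq_add_sq_of_norm_eq_one hq1
  rw [Plane.inner_eq] at *
  unfold Plane.cross at h
  linear_combination (w 0 * p 0 + w 1 * p 1) * (-h1) + (p 0 * q 0 + p 1 * q 1) * hq +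
    (w 0 * q 1 - w 1 * q 0) * h

theorem Plane.exists_unit_normal (w : Plane) : ∃ n : Plane, ‖n‖ = 1 ∧ inner ℝ w n = 0 := by
  by_cases hw : w = 0
  · exact ⟨EuclideanSpace.single 0 1, by simp, by simp [hw]⟩
  · have hw' : ‖w‖ ≠ 0 := norm_ne_zero_iff.2 hw
    have h1 : ‖‖w‖⁻¹ • w‖ = 1 := by rw [norm_smul, norm_inv, norm_norm, inv_mul_cancel₀ hw']
    refine ⟨Plane.rot (‖w‖⁻¹ • w), Plane.norm_rot h1, ?_⟩
    rw [Plane.inner_eq]; simp; ring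

/-! ### Topological disks do not lie in lines -/

/-- A planar disk does not embed into the real line. -/
theorem not_injOn_ball_plane {g : Plane → ℝ} {p : Plane} {r : ℝ} (hr : 0 < r)
    (hg : ContinuousOn g (Metric.ball p r)) : ¬ InjOn g (Metric.ball p r) := by
  intro hinj
  -- One-dimensional Borsuk-Ulam: the difference of `g` at antipodal points of a circle changes sign
  -- over half a turn, so it vanishes somewhere.
  set u : ℝ → Plane := fun θ => (r / 2) • !₂[Real.cos θ, Real.sin θ] with hu
  have hnorm : ∀ θ, ‖u θ‖ = r / 2 := by
    intro θ
    have : ‖(!₂[Real.cos θ, Real.sin θ] : Plane)‖ = 1 := by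
      rw [Plane.norm_eq_one_iff]; simp
    rw [hu, norm_smul, this, mul_one, Real.norm_of_nonneg (by positivity)]
  have hcont : Continuous u := by
    have : Continuous fun θ : ℝ => (!₂[Real.cos θ, Real.sin θ] : Plane) := by
      refine (PiLp.continuous_toLp 2 _).comp (continuous_pi fun i => ?_)
      fin_cases i
      · exact Real.continuous_cos
      · exact Real.continuous_sin
    exact this.const_smul (r / 2)
  have hp : ∀ θ, p + u θ ∈ Metric.ball p r := by
    intro θ; rw [mem_ball_iff_norm, add_sub_cancel_left, hnorm]; linarith
  have hm : ∀ θ, p - u θ ∈ Metric.ball p r := by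
    intro θ; rw [mem_ball_iff_norm, sub_sub_cancel_left, norm_neg, hnorm]; linarith
  have hF : ContinuousOn (fun θ => g (p + u θ) - g (p - u θ)) (Icc 0 Real.pi) :=
    (hg.comp (by fun_prop) fun θ _ => hp θ).sub (hg.comp (by fun_prop) fun θ _ => hm θ)
  have hpi : u Real.pi = -u 0 := by
    apply Plane.ext_coord <;> simp [hu]
  have hz : ∃ θ ∈ Icc 0 Real.pi, g (p + u θ) - g (p - u θ) = 0 := by
    rcases le_total (g (p + u 0) - g (p - u 0)) 0 with h | h
    · apply intermediate_value_Icc Real.pi_pos.le hF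
      refine ⟨h, ?_⟩
      simp only [hpi, sub_neg_eq_add, ← sub_eq_add_neg]; linarith
    · apply intermediate_value_Icc' Real.pi_pos.le hF
      refine ⟨?_, h⟩
      simp only [hpi, sub_neg_eq_add, ← sub_eq_add_neg]; linarith
  obtain ⟨θ, -, hθ⟩ := hz
  have := hinj (hp θ) (hm θ) (sub_eq_zero.1 hθ)
  have h2 : (2 : ℝ) • u θ = 0 := by
    rw [two_smul, ← sub_neg_eq_add]; rw [sub_eq_add_neg p] at this
    exact sub_eq_zero.2 (add_left_cancel this)
  have h3 := hnorm θ
  rw [(smul_eq_zero.1 h2).resolve_left two_ne_zero, norm_zero] at h3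
  linarith

theorem IsPolygonalDisk.isClosed {K : Set Plane} (hK : IsPolygonalDisk K) : IsClosed K := by
  obtain ⟨e⟩ := hK.2
  have : CompactSpace (Metric.closedBall (0 : Plane) 1) :=
    isCompact_iff_compactSpace.1 (isCompact_closedBall 0 1)
  have : CompactSpace K := e.symm.compactSpace
  exact (isCompact_iff_compactSpace.2 this).isClosed

/-- Near each of its points, a topological disk is not contained in a line. -/
theorem not_subset_line_of_homeomorph_closedBall {K : Set Plane}
    (e : K ≃ₜ Metric.closedBall (0 : Plane) 1) {x n : Plane} (hx : x ∈ K) (hn : ‖n‖ = 1) {ε : ℝ}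
    (hε : 0 < ε) : ¬ K ∩ Metric.ball x ε ⊆ {y | inner ℝ (y - x) n = 0} := by
  intro hline
  have hcont : Continuous fun d => (e.symm d : Plane) := continuous_subtype_val.comp e.symm.continuous
  obtain ⟨W, hW, hWeq⟩ := isOpen_induced_iff.1 ((Metric.isOpen_ball (x := x) (ε := ε)).preimage hcont)
  have hxW : ((e ⟨x, hx⟩ : _) : Plane) ∈ W := by
    have : e ⟨x, hx⟩ ∈ Subtype.val ⁻¹' W := by rw [hWeq]; simpa using hε
    exact this
  have hcl : ((e ⟨x, hx⟩ : _) : Plane) ∈ closure (Metric.ball (0 : Plane) 1) := by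
    rw [closure_ball _ one_ne_zero]; exact (e ⟨x, hx⟩).2
  -- `x` may correspond to a boundary point of the unit disk; a nearby interior point `p` leaves
  -- room for a full ball.
  obtain ⟨p, hpW, hp⟩ := mem_closure_iff.1 hcl W hW hxW
  obtain ⟨r, hr, hball⟩ := Metric.isOpen_iff.1 (hW.inter Metric.isOpen_ball) p ⟨hpW, hp⟩
  have hmem : ∀ q ∈ Metric.ball p r, q ∈ Metric.closedBall (0 : Plane) 1 := fun q hq =>
    Metric.ball_subset_closedBall (hball hq).2
  classical
  -- The coordinate along the line; the value 0 outside the closed disk is never used.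
  let g : Plane → ℝ := fun q =>
    if h : q ∈ Metric.closedBall (0 : Plane) 1 then inner ℝ (e.symm ⟨q, h⟩ : Plane) (Plane.rot n) else 0
  have hg : ∀ q (hq : q ∈ Metric.ball p r), g q = inner ℝ (e.symm ⟨q, hmem q hq⟩ : Plane) (Plane.rot n) :=
    fun q hq => dif_pos (hmem q hq)
  have hon : ∀ q (hq : q ∈ Metric.ball p r), inner ℝ ((e.symm ⟨q, hmem q hq⟩ : Plane) - x) n = 0 := by
    intro q hq
    refine hline ⟨(e.symm ⟨q, hmem q hq⟩).2, ?_⟩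
    have : (⟨q, hmem q hq⟩ : Metric.closedBall (0 : Plane) 1) ∈ Subtype.val ⁻¹' W := (hball hq).1
    rw [hWeq] at this
    exact this
  refine not_injOn_ball_plane (g := g) (p := p) hr ?_ ?_
  · rw [continuousOn_iff_continuous_domRestrict]
    have h1 : Continuous fun q : Metric.ball p r =>
        inner ℝ (e.symm ⟨q.1, hmem q.1 q.2⟩ : Plane) (Plane.rot n) :=
      (hcont.comp (continuous_subtype_val.subtype_mk _)).inner continuous_const
    exact h1.congr fun q => (hg q.1 q.2).symm
  · intro q hq q' hq' h
    rw [hg q hq, hg q' hq'] at h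
    have h2 : (e.symm ⟨q, hmem q hq⟩ : Plane) - e.symm ⟨q', hmem q' hq'⟩ = 0 := by
      have h0 : inner ℝ ((e.symm ⟨q, hmem q hq⟩ : Plane) - e.symm ⟨q', hmem q' hq'⟩) n = 0 := by
        have := hon q hq; have h' := hon q' hq'
        rw [inner_sub_left] at *; linarith
      rw [Plane.eq_smul_rot hn h0, inner_sub_left, h, sub_self, zero_smul]
    have := e.symm.injective (Subtype.ext (sub_eq_zero.1 h2))
    simpa using this

/-! ### The frontier of a regular polytope: edge lines, normals, vertices -/

theorem IsPreconnected.subset_or_subset_compl_of_disjoint_frontier {X : Type*} [TopologicalSpace X]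
    {s A : Set X} (hs : IsPreconnected s) (h : Disjoint s (frontier A)) : s ⊆ A ∨ s ⊆ Aᶜ := by
  have hsub : s ⊆ interior A ∪ (closure A)ᶜ := by
    intro x hx
    by_contra hx'
    rw [mem_union, not_or, notMem_compl_iff] at hx'
    exact disjoint_left.1 h hx ⟨hx'.2, hx'.1⟩
  have hd : Disjoint (interior A) (closure A)ᶜ :=
    disjoint_compl_right.mono_left (interior_subset.trans subset_closure)
  rcases hs.subset_or_subset isOpen_interior isClosed_closure.isOpen_compl hd hsub with h | h
  · exact Or.inl (h.trans interior_subset)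
  · exact Or.inr (h.trans (compl_subset_compl.2 subset_closure))

theorem frontier_diff_iUnion_subset {X ι : Type*} [TopologicalSpace X] [Finite ι] (A : Set X)
    (B : ι → Set X) : frontier (A \ ⋃ i, B i) ⊆ frontier A ∪ ⋃ i, frontier (B i) := by
  intro x hx
  by_contra h
  simp only [mem_union, mem_iUnion, not_or, not_exists] at h
  have key : ∀ C : Set X, x ∉ frontier C → (∀ᶠ y in 𝓝 x, y ∈ C) ∨ ∀ᶠ y in 𝓝 x, y ∉ C := by
    intro C hC
    by_cases h1 : x ∈ interior C
    · exact Or.inl (mem_interior_iff_mem_nhds.1 h1)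
    · have : x ∈ (closure C)ᶜ := fun h2 => hC ⟨h2, h1⟩
      exact Or.inr (mem_of_superset (isClosed_closure.isOpen_compl.mem_nhds this)
        (compl_subset_compl.2 subset_closure))
  have hout : ¬ ∀ᶠ y in 𝓝 x, y ∉ A \ ⋃ i, B i := fun h => mem_closure_iff_frequently.1 hx.1 h
  rcases key A h.1 with hA | hA
  · by_cases hB : ∃ i, ∀ᶠ y in 𝓝 x, y ∈ B i
    · obtain ⟨i, hi⟩ := hB
      exact hout (hi.mono fun y hy hy' => hy'.2 (mem_iUnion.2 ⟨i, hy⟩))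
    · rw [not_exists] at hB
      have hB' : ∀ᶠ y in 𝓝 x, ∀ i, y ∉ B i :=
        eventually_all.2 fun i => (key _ (h.2 i)).resolve_left (hB i)
      refine hx.2 (mem_interior_iff_mem_nhds.2 ?_)
      filter_upwards [hA, hB'] with y h1 h2
      exact ⟨h1, by simpa using h2⟩
  · exact hout (hA.mono fun y hy hy' => hy hy'.1)

theorem IsRegularPolytope.isOpen {Ω : Set Plane} (hΩ : IsRegularPolytope Ω) : IsOpen Ω := by
  obtain ⟨N, Kext, Kint, -, hint, -, -, rfl⟩ := hΩ
  exact isOpen_interior.sdiff (isClosed_iUnion_of_finite fun i => (hint i).isClosed)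

theorem IsRegularPolytope.isBounded {Ω : Set Plane} (hΩ : IsRegularPolytope Ω) :
    Bornology.IsBounded Ω := by
  obtain ⟨N, Kext, Kint, hext, -, -, -, rfl⟩ := hΩ
  exact hext.1.1.subset (sdiff_subset.trans interior_subset)

/-- The line through `p.1` with normal `p.2`. -/
def Plane.line (p : Plane × Plane) : Set Plane := {y | inner ℝ (y - p.1) p.2 = 0}

theorem Plane.isClosed_line (p : Plane × Plane) : IsClosed (Plane.line p) :=
  isClosed_eq (by fun_prop) continuous_const

theorem Plane.inner_sub_eq_zero {p : Plane × Plane} {x y : Plane} (hx : x ∈ Plane.line p)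
    (hy : y ∈ Plane.line p) : inner ℝ (y - x) p.2 = 0 := by
  simp only [Plane.line, mem_ofPred_eq, inner_sub_left] at *
  linarith

theorem Plane.exists_segment_subset_line (a b : Plane) :
    ∃ n : Plane, ‖n‖ = 1 ∧ segment ℝ a b ⊆ Plane.line (a, n) := by
  obtain ⟨n, hn, h⟩ := Plane.exists_unit_normal (b - a)
  refine ⟨n, hn, ?_⟩
  rw [segment_eq_image']
  rintro _ ⟨t, -, rfl⟩
  simp [Plane.line, inner_smul_left, h]

theorem IsBoundedPolytope.exists_finite_lines {P : Set Plane} (hP : IsBoundedPolytope P) :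
    ∃ T : Set (Plane × Plane), T.Finite ∧ (∀ p ∈ T, ‖p.2‖ = 1) ∧
      frontier P ⊆ ⋃ p ∈ T, Plane.line p := by
  obtain ⟨-, S, hS, hfr⟩ := hP
  choose n hn hsub using Plane.exists_segment_subset_line
  refine ⟨(fun s : Plane × Plane => (s.1, n s.1 s.2)) '' S, hS.image _, ?_, ?_⟩
  · rintro _ ⟨s, -, rfl⟩
    exact hn _ _
  · rw [hfr, biUnion_image]
    exact iUnion₂_mono fun s _ => hsub _ _

theorem IsRegularPolytope.exists_finite_lines {Ω : Set Plane} (hΩ : IsRegularPolytope Ω) :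
    ∃ T : Set (Plane × Plane), T.Finite ∧ (∀ p ∈ T, ‖p.2‖ = 1) ∧
      frontier Ω ⊆ ⋃ p ∈ T, Plane.line p := by
  obtain ⟨N, Kext, Kint, hext, hint, -, -, rfl⟩ := hΩ
  obtain ⟨T, hT, hT1, hT2⟩ := hext.1.exists_finite_lines
  choose T' hT' hT1' hT2' using fun i => (hint i).1.exists_finite_lines
  refine ⟨T ∪ ⋃ i, T' i, hT.union (finite_iUnion hT'), ?_, ?_⟩
  · rintro p (hp | hp)
    · exact hT1 p hp
    · obtain ⟨i, hi⟩ := mem_iUnion.1 hp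
      exact hT1' i p hi
  · refine (frontier_diff_iUnion_subset _ _).trans ?_
    rw [biUnion_union]
    refine union_subset_union (frontier_interior_subset.trans hT2) (iUnion_subset fun i => ?_)
    refine (hT2' i).trans (biUnion_subset_biUnion_left ?_)
    exact subset_iUnion T' i

/-- Each side of a line near a point not met by the frontier lies in `Ω` or in its complement. -/
theorem halfDisk_subset_or {Ω : Set Plane} {x n : Plane} {ε : ℝ}
    (h : ∀ y ∈ Metric.ball x ε, y ∈ frontier Ω → inner ℝ (y - x) n = 0) :
    (Metric.ball x ε ∩ {y | inner ℝ (y - x) n < 0} ⊆ Ω) ∨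
      (Metric.ball x ε ∩ {y | inner ℝ (y - x) n < 0} ⊆ Ωᶜ) := by
  refine IsPreconnected.subset_or_subset_compl_of_disjoint_frontier ?_ ?_
  · refine (Convex.inter (convex_ball x ε) ?_).isPreconnected
    have : {y | inner ℝ (y - x) n < 0} = {y | innerSL ℝ n y < inner ℝ x n} := by
      ext y
      simp [inner_sub_left, real_inner_comm]
    rw [this]
    exact convex_halfSpace_lt (innerSL ℝ n).toLinearMap.isLinear _
  · rw [disjoint_left]
    rintro y ⟨hy, hy'⟩ hfr
    exact (h y hy hfr).not_lt hy'

/-- At a point near which the frontier of a regular polytope lies in a line, that line has an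
outward normal. -/
theorem IsRegularPolytope.isOutwardNormal_of_frontier_subset_line {Ω : Set Plane}
    (hΩ : IsRegularPolytope Ω) {x n : Plane} (hx : x ∈ frontier Ω) (hn : ‖n‖ = 1)
    (h : ∀ᶠ y in 𝓝 x, y ∈ frontier Ω → inner ℝ (y - x) n = 0) :
    IsOutwardNormal Ω x n ∨ IsOutwardNormal Ω x (-n) := by
  have hopen := hΩ.isOpen
  obtain ⟨ε, hε, hball⟩ := Metric.eventually_nhds_iff_ball.1 h
  have hball' : ∀ y ∈ Metric.ball x ε, y ∈ frontier Ω → inner ℝ (y - x) (-n) = 0 := by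
    intro y hy hy'
    rw [inner_neg_right, hball y hy hy', neg_zero]
  have hdense : ∀ y ∈ Metric.ball x ε, inner ℝ (y - x) n = 0 → ∀ m : Plane, m = n ∨ m = -n →
      y ∈ closure (Metric.ball x ε ∩ {y | inner ℝ (y - x) m < 0}) := by
    intro y hy hy0 m hm
    have hmn : inner ℝ m m = (1 : ℝ) := by
      rcases hm with rfl | rfl <;> simp [hn]
    have hym : inner ℝ (y - x) m = 0 := by
      rcases hm with rfl | rfl <;> simp [hy0]
    have hlim : Tendsto (fun t : ℝ => y - t • m) (𝓝[>] 0) (𝓝 y) := by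
      have : Tendsto (fun t : ℝ => y - t • m) (𝓝 0) (𝓝 (y - (0 : ℝ) • m)) :=
        Continuous.tendsto (by fun_prop) 0
      rw [zero_smul, sub_zero] at this
      exact this.mono_left nhdsWithin_le_nhds
    refine mem_closure_of_tendsto hlim ?_
    filter_upwards [hlim.eventually (Metric.isOpen_ball.mem_nhds hy), self_mem_nhdsWithin]
      with t ht ht0
    refine ⟨ht, ?_⟩
    have : y - t • m - x = (y - x) - t • m := by abel
    rw [mem_ofPred_eq, this, inner_sub_left, hym, inner_smul_left, hmn]
    simpa using ht0
  -- Points of the line are limits from either side, so the open set `Ω` cannot meet the line while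
  -- missing one of the sides.
  have hline : ∀ m : Plane, m = n ∨ m = -n →
      Metric.ball x ε ∩ {y | inner ℝ (y - x) m < 0} ⊆ Ωᶜ →
      ∀ y ∈ Metric.ball x ε, inner ℝ (y - x) n = 0 → y ∉ Ω := by
    intro m hm hsub y hy hy0 hyΩ
    obtain ⟨z, hz, hz'⟩ := mem_closure_iff.1 (hdense y hy hy0 m hm) Ω hopen hyΩ
    exact hsub hz' hz
  have hpos : ∀ y, 0 < inner ℝ (y - x) n ↔ inner ℝ (y - x) (-n) < 0 := by
    intro y; rw [inner_neg_right, neg_lt_zero]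
  have hxb : x ∈ Metric.ball x ε := Metric.mem_ball_self hε
  have hx0 : inner ℝ (x - x) n = 0 := by simp
  rcases halfDisk_subset_or hball with h1 | h1 <;> rcases halfDisk_subset_or hball' with h2 | h2
  -- If both sides are in `Ω`, the ball lies in `Kext`, so `x` belongs to a hole; near `x` that hole
  -- is confined to the line, which a topological disk cannot be.
  · exfalso
    obtain ⟨N, Kext, Kint, hext, hint, -, -, rfl⟩ := hΩ
    have hbK : Metric.ball x ε ⊆ Kext := by
      intro y hy
      rcases lt_trichotomy (inner ℝ (y - x) n) 0 with h | h | h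
      · exact interior_subset (h1 ⟨hy, h⟩).1
      · have := closure_mono (h1.trans sdiff_subset) (hdense y hy h n (Or.inl rfl))
        exact closure_minimal interior_subset hext.isClosed this
      · exact interior_subset (h2 ⟨hy, (hpos y).1 h⟩).1
    have hxint : x ∈ interior Kext :=
      mem_interior.2 ⟨_, hbK, Metric.isOpen_ball, hxb⟩
    have hxU : x ∈ ⋃ i, Kint i := by
      by_contra hxU
      have : x ∈ interior (interior Kext \ ⋃ i, Kint i) := by
        rw [hopen.interior_eq]; exact ⟨hxint, hxU⟩
      exact hx.2 this
    obtain ⟨i, hi⟩ := mem_iUnion.1 hxU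
    obtain ⟨e⟩ := (hint i).2
    refine not_subset_line_of_homeomorph_closedBall e hi hn hε ?_
    rintro y ⟨hyK, hy⟩
    rcases lt_trichotomy (inner ℝ (y - x) n) 0 with h | h | h
    · exact absurd (mem_iUnion.2 ⟨i, hyK⟩) (h1 ⟨hy, h⟩).2
    · exact h
    · exact absurd (mem_iUnion.2 ⟨i, hyK⟩) (h2 ⟨hy, (hpos y).1 h⟩).2
  · left
    refine ⟨hn, ε, hε, fun y hy => ⟨fun hyΩ => ?_, fun h => h1 ⟨hy, h⟩⟩⟩
    by_contra hcon
    rcases (not_lt.1 hcon).eq_or_lt with h | h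
    · exact hline (-n) (Or.inr rfl) h2 y hy h.symm hyΩ
    · exact h2 ⟨hy, (hpos y).1 h⟩ hyΩ
  · right
    refine ⟨by rwa [norm_neg], ε, hε, fun y hy => ⟨fun hyΩ => ?_, fun h => h2 ⟨hy, h⟩⟩⟩
    by_contra hcon
    rw [← hpos, not_lt] at hcon
    rcases hcon.eq_or_lt with h | h
    · exact hline n (Or.inl rfl) h1 y hy h hyΩ
    · exact h1 ⟨hy, h⟩ hyΩ
  · exfalso
    obtain ⟨y, hy, hyΩ⟩ := mem_closure_iff.1 (frontier_subset_closure hx) _ Metric.isOpen_ball hxb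
    rcases lt_trichotomy (inner ℝ (y - x) n) 0 with h | h | h
    · exact h1 ⟨hy, h⟩ hyΩ
    · exact hline n (Or.inl rfl) h1 y hy h hyΩ
    · exact h2 ⟨hy, (hpos y).1 h⟩ hyΩ

/-- All but finitely many points of the frontier of a regular polytope have an outward normal; at
the remaining points every continuous tangential field vanishes. -/
theorem IsRegularPolytope.exists_finite_vertices {Ω : Set Plane} (hΩ : IsRegularPolytope Ω) :
    ∃ V : Set Plane, V.Finite ∧ ∀ v ∈ frontier Ω, (∃ n, IsOutwardNormal Ω v n) ∨
      (v ∈ V ∧ ∀ ψ : Plane → Plane, ContinuousOn ψ (closure Ω) →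
        (∀ x ∈ frontier Ω, ∀ n : Plane, IsOutwardNormal Ω x n → inner ℝ (ψ x) n = 0) →
        ψ v = 0) := by
  obtain ⟨T, hT, hT1, hcover⟩ := hΩ.exists_finite_lines
  -- Candidate vertices: the crossings of non-parallel covering lines, whether or not they are true
  -- corners.
  set V : Set Plane := ⋃ p ∈ T, ⋃ q ∈ T,
    {v | Plane.cross p.2 q.2 ≠ 0 ∧ v ∈ Plane.line p ∧ v ∈ Plane.line q} with hV
  have hVfin : V.Finite := by
    refine hT.biUnion fun p _ => hT.biUnion fun q _ => Set.Subsingleton.finite ?_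
    rintro v ⟨hc, h1, h2⟩ w ⟨-, h3, h4⟩
    exact sub_eq_zero.1 (Plane.eq_zero_of_cross_ne_zero hc (Plane.inner_sub_eq_zero h3 h1)
      (Plane.inner_sub_eq_zero h4 h2))
  have hmemV : ∀ {v p q}, p ∈ T → q ∈ T → v ∉ V → v ∈ Plane.line p → v ∈ Plane.line q →
      Plane.cross p.2 q.2 = 0 := by
    intro v p q hp hq hv h1 h2
    by_contra hc
    exact hv (mem_biUnion hp (mem_biUnion hq ⟨hc, h1, h2⟩))
  have hreg : ∀ p ∈ T, ∀ y ∈ frontier Ω, y ∈ Plane.line p → y ∉ V →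
      IsOutwardNormal Ω y p.2 ∨ IsOutwardNormal Ω y (-p.2) := by
    intro p hp y hy hyp hyV
    refine hΩ.isOutwardNormal_of_frontier_subset_line hy (hT1 p hp) ?_
    have hev : ∀ᶠ z in 𝓝 y, ∀ q ∈ T, y ∉ Plane.line q → z ∉ Plane.line q :=
      (hT.eventually_all).2 fun q _ => by
        by_cases hq : y ∈ Plane.line q
        · exact Eventually.of_forall fun z h => absurd hq h
        · exact mem_of_superset ((Plane.isClosed_line q).isOpen_compl.mem_nhds hq) fun z hz _ => hz
    filter_upwards [hev] with z hz hzfr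
    obtain ⟨q, hq, hzq⟩ := mem_iUnion₂.1 (hcover hzfr)
    have hyq : y ∈ Plane.line q := by
      by_contra h
      exact hz q hq h hzq
    exact Plane.inner_eq_zero_of_cross_eq_zero (hT1 q hq) (hmemV hp hq hyV hyp hyq)
      (Plane.inner_sub_eq_zero hyq hzq)
  refine ⟨V, hVfin, fun v hv => ?_⟩
  -- The lines along which frontier points outside `V` accumulate at `v`. Two non-parallel ones make
  -- `v` a genuine corner; otherwise the frontier near `v` lies in a single line.
  set A : Set (Plane × Plane) := {p ∈ T | v ∈ closure ((frontier Ω ∩ Plane.line p) \ V)} with hA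
  have hAline : ∀ p ∈ A, v ∈ Plane.line p := fun p hp =>
    closure_minimal (sdiff_subset.trans inter_subset_right) (Plane.isClosed_line p) hp.2
  have hnear : ∀ᶠ y in 𝓝 v, y ∈ frontier Ω → y = v ∨ ∃ p ∈ A, y ∈ Plane.line p := by
    have h1 : ∀ᶠ y in 𝓝 v, ∀ q ∈ T, q ∉ A → y ∉ (frontier Ω ∩ Plane.line q) \ V :=
      (hT.eventually_all).2 fun q hq => by
        by_cases hqA : q ∈ A
        · exact Eventually.of_forall fun z h => absurd hqA h
        · have : v ∉ closure ((frontier Ω ∩ Plane.line q) \ V) := fun h => hqA ⟨hq, h⟩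
          exact mem_of_superset (isClosed_closure.isOpen_compl.mem_nhds this)
            fun z hz _ hz' => hz (subset_closure hz')
    have h2 : ∀ᶠ y in 𝓝 v, y ∉ V \ {v} :=
      (hVfin.subset sdiff_subset).isClosed.isOpen_compl.mem_nhds (by simp)
    filter_upwards [h1, h2] with y hy1 hy2 hyfr
    by_cases hyv : y = v
    · exact Or.inl hyv
    · right
      have hyV : y ∉ V := fun h => hy2 ⟨h, hyv⟩
      obtain ⟨q, hq, hyq⟩ := mem_iUnion₂.1 (hcover hyfr)
      refine ⟨q, ?_, hyq⟩
      by_contra hqA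
      exact hy1 q hq hqA ⟨⟨hyfr, hyq⟩, hyV⟩
  by_cases hpar : ∃ p ∈ A, ∃ q ∈ A, Plane.cross p.2 q.2 ≠ 0
  · right
    obtain ⟨p, hp, q, hq, hc⟩ := hpar
    refine ⟨mem_biUnion hp.1 (mem_biUnion hq.1 ⟨hc, hAline p hp, hAline q hq⟩), ?_⟩
    intro ψ hψ htan
    -- The tangency condition at nearby points outside `V` passes to the limit.
    have key : ∀ p ∈ A, inner ℝ (ψ v) p.2 = 0 := by
      intro p hp
      have hcont : ContinuousWithinAt (fun y => inner ℝ (ψ y) p.2)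
          ((frontier Ω ∩ Plane.line p) \ V) v :=
        ((hψ v (frontier_subset_closure hv)).inner continuousWithinAt_const).mono
          ((sdiff_subset.trans inter_subset_left).trans frontier_subset_closure)
      have := hcont.mem_closure (t := {(0 : ℝ)}) hp.2 fun y hy => by
        rcases hreg p hp.1 y hy.1.1 hy.1.2 hy.2 with h | h
        · exact htan y hy.1.1 _ h
        · have := htan y hy.1.1 _ h
          rw [inner_neg_right, neg_eq_zero] at this
          exact this
      simpa using this
    exact Plane.eq_zero_of_cross_ne_zero hc (key p hp) (key q hq)
  · left
    push Not at hpar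
    -- If `A` is empty, `v` is isolated in the frontier and any direction serves.
    obtain ⟨m, hm, hmA⟩ : ∃ m : Plane, ‖m‖ = 1 ∧ ∀ p ∈ A, Plane.cross m p.2 = 0 := by
      by_cases hne : A.Nonempty
      · obtain ⟨p, hp⟩ := hne
        exact ⟨p.2, hT1 p hp.1, hpar p hp⟩
      · obtain ⟨m, hm, -⟩ := Plane.exists_unit_normal 0
        exact ⟨m, hm, fun p hp => absurd ⟨p, hp⟩ hne⟩
    have := hΩ.isOutwardNormal_of_frontier_subset_line hv hm (by
      filter_upwards [hnear] with y hy hyfr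
      rcases hy hyfr with rfl | ⟨p, hp, hyp⟩
      · simp
      · exact Plane.inner_eq_zero_of_cross_eq_zero (hT1 p hp.1) (hmA p hp)
          (Plane.inner_sub_eq_zero (hAline p hp) hyp))
    exact this.elim (fun h => ⟨_, h⟩) fun h => ⟨_, h⟩

/-! ### One-dimensional permutations and the determinant in a rotated frame -/

theorem exists_Ioo_maximal {G : Set ℝ} (hG : IsOpen G) (hb : Bornology.IsBounded G) {s : ℝ}
    (hs : s ∈ G) : ∃ a b, s ∈ Ioo a b ∧ Ioo a b ⊆ G ∧ a ∉ G ∧ b ∉ G := by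
  obtain ⟨l, hl⟩ := hb.bddBelow
  obtain ⟨u, hu⟩ := hb.bddAbove
  have hGc : IsClosed Gᶜ := hG.isClosed_compl
  have hA := (hGc.inter (isClosed_Iic (a := s))).csSup_mem
    ⟨l - 1, fun h => by linarith [hl h], by have := hl hs; simp only [mem_Iic]; linarith⟩
    (bddAbove_Iic.mono inter_subset_right)
  have hB := (hGc.inter (isClosed_Ici (a := s))).csInf_mem
    ⟨u + 1, fun h => by linarith [hu h], by have := hu hs; simp only [mem_Ici]; linarith⟩
    (bddBelow_Ici.mono inter_subset_right)
  set a := sSup (Gᶜ ∩ Iic s) with ha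
  set b := sInf (Gᶜ ∩ Ici s) with hb
  refine ⟨a, b, ⟨?_, ?_⟩, ?_, hA.1, hB.1⟩
  · exact lt_of_le_of_ne hA.2 fun h => hA.1 (h ▸ hs)
  · exact lt_of_le_of_ne hB.2 fun h => hB.1 (h ▸ hs)
  · intro t ht
    by_contra htG
    rcases le_total t s with h | h
    · exact absurd (le_csSup (bddAbove_Iic.mono inter_subset_right) ⟨htG, h⟩) (not_le.2 ht.1)
    · exact absurd (csInf_le (bddBelow_Ici.mono inter_subset_right) ⟨htG, h⟩) (not_le.2 ht.2)

/-- A map of the line which has nonvanishing derivative on a bounded open set and fixes the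
boundary points of that set permutes it, and is increasing there. -/
theorem bijOn_of_deriv_ne_zero_of_fixed {G : Set ℝ} (hG : IsOpen G) (hb : Bornology.IsBounded G)
    {h : ℝ → ℝ} (hcont : ContinuousOn h (closure G)) (hfix : ∀ s ∈ closure G, s ∉ G → h s = s)
    {h' : ℝ → ℝ} (hder : ∀ s ∈ G, HasDerivAt h (h' s) s) (hne : ∀ s ∈ G, h' s ≠ 0) :
    BijOn h G G ∧ ∀ s ∈ G, 0 < h' s := by
  -- On each component Rolle's theorem gives injectivity, and the fixed endpoints force `h` to
  -- increase.
  have key : ∀ s ∈ G, ∃ a b, s ∈ Ioo a b ∧ Ioo a b ⊆ G ∧ a ∉ G ∧ b ∉ G ∧ h a = a ∧ h b = b ∧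
      ContinuousOn h (Icc a b) ∧ StrictMonoOn h (Icc a b) := by
    intro s hs
    obtain ⟨a, b, hsab, hsub, ha, hb⟩ := exists_Ioo_maximal hG hb hs
    have hab : a < b := hsab.1.trans hsab.2
    have hIcc : Icc a b ⊆ closure G := by
      rw [← closure_Ioo hab.ne]; exact closure_mono hsub
    have hfa := hfix a (hIcc (left_mem_Icc.2 hab.le)) ha
    have hfb := hfix b (hIcc (right_mem_Icc.2 hab.le)) hb
    have hinj : InjOn h (Icc a b) := by
      have : ∀ x ∈ Icc a b, ∀ y ∈ Icc a b, x < y → h x ≠ h y := by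
        intro x hx y hy hxy heq
        obtain ⟨c, hc, hc'⟩ := exists_hasDerivAt_eq_zero (f' := h') hxy
          (hcont.mono ((Icc_subset_Icc hx.1 hy.2).trans hIcc)) heq
          fun t ht => hder t (hsub ⟨hx.1.trans_lt ht.1, ht.2.trans_le hy.2⟩)
        exact hne c (hsub ⟨hx.1.trans_lt hc.1, hc.2.trans_le hy.2⟩) hc'
      intro x hx y hy heq
      rcases lt_trichotomy x y with hlt | rfl | hlt
      · exact absurd heq (this x hx y hy hlt)
      · rfl
      · exact absurd heq.symm (this y hy x hx hlt)
    exact ⟨a, b, hsab, hsub, ha, hb, hfa, hfb, hcont.mono hIcc,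
      (hcont.mono hIcc).strictMonoOn_of_injOn_Icc hab.le (by rw [hfa, hfb]; exact hab.le) hinj⟩
  refine ⟨⟨?_, ?_, ?_⟩, ?_⟩
  · intro s hs
    obtain ⟨a, b, hsab, hsub, -, -, hfa, hfb, -, hmono⟩ := key s hs
    have hab : a ≤ b := (hsab.1.trans hsab.2).le
    refine hsub ⟨?_, ?_⟩
    · have := hmono (left_mem_Icc.2 hab) (Ioo_subset_Icc_self hsab) hsab.1
      rwa [hfa] at this
    · have := hmono (Ioo_subset_Icc_self hsab) (right_mem_Icc.2 hab) hsab.2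
      rwa [hfb] at this
  · have : ∀ x ∈ G, ∀ y ∈ G, x < y → h x ≠ h y := by
      intro x hx y hy hxy
      obtain ⟨a, b, hxab, -, -, hb, -, hfb, -, hmono⟩ := key x hx
      obtain ⟨a', b', hyab, hsub', -, -, hfa', -, -, hmono'⟩ := key y hy
      have hb1 : h x < b := by
        have := hmono (Ioo_subset_Icc_self hxab) (right_mem_Icc.2 (hxab.1.trans hxab.2).le) hxab.2
        rwa [hfb] at this
      have ha1 : a' < h y := by
        have := hmono' (left_mem_Icc.2 (hyab.1.trans hyab.2).le) (Ioo_subset_Icc_self hyab) hyab.1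
        rwa [hfa'] at this
      rcases lt_or_ge y b with hyb | hyb
      · exact (hmono (Ioo_subset_Icc_self hxab) ⟨(hxab.1.trans hxy).le, hyb.le⟩ hxy).ne
      -- Distinct components are disjoint intervals, each mapped into itself.
      · have : b ≤ a' := by
          by_contra hcon
          refine hb (hsub' ⟨not_le.1 hcon, ?_⟩)
          exact lt_of_le_of_lt hyb hyab.2
        linarith
    intro x hx y hy heq
    rcases lt_trichotomy x y with hlt | rfl | hlt
    · exact absurd heq (this x hx y hy hlt)
    · rfl
    · exact absurd heq.symm (this y hy x hx hlt)
  · intro t ht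
    obtain ⟨a, b, htab, hsub, -, -, hfa, hfb, hc, -⟩ := key t ht
    have := intermediate_value_Ioo (htab.1.trans htab.2).le hc (by rw [hfa, hfb]; exact htab)
    exact image_mono hsub this
  · intro s hs
    obtain ⟨a, b, hsab, hsub, -, -, -, -, -, hmono⟩ := key s hs
    refine lt_of_le_of_ne ?_ (hne s hs).symm
    have hnhds : Icc a b ∈ 𝓝 s := Icc_mem_nhds hsab.1 hsab.2
    have := (hder s hs).hasDerivWithinAt (s := Icc a b)
    have h2 := this.derivWithin (uniqueDiffOn_Icc (hsab.1.trans hsab.2) s (Ioo_subset_Icc_self hsab))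
    rw [← h2]
    exact hmono.monotoneOn.derivWithin_nonneg

/-- When `L` preserves the direction tangent to an edge the second product vanishes, and the sign of
the determinant ties the normal stretch to the tangential one. -/
theorem Plane.det_eq (L : Plane →L[ℝ] Plane) {n : Plane} (hn : ‖n‖ = 1) :
    L.det = inner ℝ (L (Plane.rot n)) (Plane.rot n) * inner ℝ (L n) n -
      inner ℝ (L (Plane.rot n)) n * inner ℝ (L n) (Plane.rot n) := by
  set e : Fin 2 → Plane := fun i => EuclideanSpace.single i 1 with he
  have hexp : ∀ v : Plane, v = v 0 • e 0 + v 1 • e 1 := by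
    intro v
    apply Plane.ext_coord <;> simp [he]
  have hdet : L.det = (L (e 0)) 0 * (L (e 1)) 1 - (L (e 1)) 0 * (L (e 0)) 1 := by
    rw [ContinuousLinearMap.det, ← LinearMap.det_toMatrix (EuclideanSpace.basisFun (Fin 2) ℝ).toBasis,
      Matrix.det_fin_two]
    simp [LinearMap.toMatrix_apply, he]
  have hL : ∀ v : Plane, ∀ i, (L v) i = v 0 * (L (e 0)) i + v 1 * (L (e 1)) i := by
    intro v i
    conv_lhs => rw [hexp v]
    simp
  have h1 := Plane.sq_add_sq_of_norm_eq_one hn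
  rw [hdet]
  simp only [Plane.inner_eq, hL n, hL (Plane.rot n), Plane.rot_zero, Plane.rot_one]
  generalize (L (e 0)) 0 = a
  generalize (L (e 0)) 1 = b
  generalize (L (e 1)) 0 = c
  generalize (L (e 1)) 1 = d
  linear_combination (-(n 0 ^ 2 + n 1 ^ 2) - 1) * (a * d - c * b) * h1

/-! ### Local geometry at a point with an outward normal -/

namespace IsOutwardNormal

variable {Ω : Set Plane} {x n : Plane}

theorem eventually_mem_iff (h : IsOutwardNormal Ω x n) :
    ∀ᶠ y in 𝓝 x, (y ∈ Ω ↔ inner ℝ (y - x) n < 0) := by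
  obtain ⟨-, ε, hε, hball⟩ := h
  exact Metric.eventually_nhds_iff_ball.2 ⟨ε, hε, hball⟩

theorem inner_self (h : IsOutwardNormal Ω x n) : inner ℝ n n = (1 : ℝ) := by
  rw [real_inner_self_eq_norm_sq, h.1, one_pow]

theorem notMem (h : IsOutwardNormal Ω x n) : x ∉ Ω := by
  rw [h.eventually_mem_iff.self_of_nhds]; simp

theorem tendsto_add_smul (x v : Plane) : Tendsto (fun t : ℝ => x + t • v) (𝓝[>] 0) (𝓝 x) := by
  have : Tendsto (fun t : ℝ => x + t • v) (𝓝 0) (𝓝 (x + (0 : ℝ) • v)) :=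
    Continuous.tendsto (by fun_prop) 0
  rw [zero_smul, add_zero] at this
  exact this.mono_left nhdsWithin_le_nhds

theorem mem_closure (h : IsOutwardNormal Ω x n) : x ∈ closure Ω := by
  have hlim := tendsto_add_smul x (-n)
  refine mem_closure_of_tendsto hlim ?_
  filter_upwards [hlim.eventually h.eventually_mem_iff, self_mem_nhdsWithin] with t ht ht0
  rw [ht]
  simpa [inner_smul_left, h.1] using ht0

theorem mem_frontier (h : IsOutwardNormal Ω x n) : x ∈ frontier Ω :=
  ⟨h.mem_closure, fun hx => h.notMem (interior_subset hx)⟩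

theorem eventually_of_inner_eq_zero (h : IsOutwardNormal Ω x n) :
    ∀ᶠ y in 𝓝 x, inner ℝ (y - x) n = 0 → IsOutwardNormal Ω y n := by
  filter_upwards [h.eventually_mem_iff.eventually_nhds] with y hy hy0
  obtain ⟨ε, hε, hball⟩ := Metric.eventually_nhds_iff_ball.1 hy
  refine ⟨h.1, ε, hε, fun z hz => ?_⟩
  rw [hball z hz]
  have : z - x = (z - y) + (y - x) := by abel
  rw [this, inner_add_left, hy0, add_zero]

theorem eventually_of_mem_frontier (hΩ : IsOpen Ω) (h : IsOutwardNormal Ω x n) :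
    ∀ᶠ y in 𝓝 x, y ∈ frontier Ω → inner ℝ (y - x) n = 0 ∧ IsOutwardNormal Ω y n := by
  filter_upwards [h.eventually_of_inner_eq_zero, h.eventually_mem_iff.eventually_nhds]
    with y hy hev hfr
  have h0 : inner ℝ (y - x) n = 0 := by
    rcases lt_trichotomy (inner ℝ (y - x) n) 0 with hlt | heq | hgt
    · rw [← hev.self_of_nhds] at hlt
      rw [hΩ.frontier_eq] at hfr
      exact absurd hlt hfr.2
    · exact heq
    · have hpos : ∀ᶠ z in 𝓝 y, 0 < inner ℝ (z - x) n := by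
        have hc : Continuous fun z : Plane => inner ℝ (z - x) n := by fun_prop
        exact hc.continuousAt.eventually_const_lt hgt
      exfalso
      refine mem_closure_iff_frequently.1 (frontier_subset_closure hfr) ?_
      filter_upwards [hev, hpos] with z hz hz' hzΩ
      exact (hz.1 hzΩ).not_gt hz'
  exact ⟨h0, hy h0⟩

theorem unique {m : Plane} (h : IsOutwardNormal Ω x n) (h' : IsOutwardNormal Ω x m) : n = m := by
  by_contra hne
  have hlt : inner ℝ n m < (1 : ℝ) := (inner_lt_one_iff_real_of_norm_eq_one h.1 h'.1).2 hne
  -- A short move along `m - n` enters `Ω` according to `n` but not according to `m`.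
  have hlim := tendsto_add_smul x (m - n)
  obtain ⟨t, ⟨ht1, ht2⟩, ht⟩ := ((hlim.eventually (h.eventually_mem_iff.and
    h'.eventually_mem_iff)).and self_mem_nhdsWithin).exists
  rw [ht1] at ht2
  simp only [add_sub_cancel_left, inner_smul_left, inner_sub_left, h.inner_self, h'.inner_self,
    real_inner_comm n m] at ht2
  replace ht : 0 < t := ht
  have h1 : t * (inner ℝ n m - 1) < 0 := mul_neg_of_pos_of_neg ht (by linarith)
  have h2 : ¬ t * (1 - inner ℝ n m) < 0 := not_lt.2 (mul_nonneg ht.le (by linarith))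
  simp only [real_inner_comm m n, RCLike.conj_to_real] at ht2 h1 h2
  exact h2 (ht2.1 h1)

theorem exists_convex_inter_ball (h : IsOutwardNormal Ω x n) :
    ∃ ε > 0, ∀ r ≤ ε, Convex ℝ (Ω ∩ Metric.ball x r) := by
  obtain ⟨-, ε, hε, hball⟩ := h
  refine ⟨ε, hε, fun r hr => ?_⟩
  have : Ω ∩ Metric.ball x r = {y | innerSL ℝ n y < inner ℝ x n} ∩ Metric.ball x r := by
    ext y
    simp only [mem_inter_iff, and_congr_left_iff]
    intro hy
    rw [hball y (Metric.ball_subset_ball hr hy)]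
    simp [inner_sub_left, real_inner_comm]
  rw [this]
  exact (convex_halfSpace_lt (innerSL ℝ n).toLinearMap.isLinear _).inter (convex_ball x r)

end IsOutwardNormal

/-! ### Sliding maps and their action on the boundary -/

/-- A map of the closure of `Ω` which is regular up to the boundary with positive Jacobian, slides
along the boundary at the points with an outward normal, and fixes the other boundary points. -/
structure IsSlidingMap (Ω : Set Plane) (Φ : Plane → Plane) : Prop where
  isOpen : IsOpen Ω
  isBounded : Bornology.IsBounded Ω
  continuousOn : ContinuousOn Φ (closure Ω)
  differentiableOn : DifferentiableOn ℝ Φ Ω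
  exists_tendsto : ∀ x ∈ closure Ω, ∃ L : Plane →L[ℝ] Plane,
    Tendsto (fderiv ℝ Φ) (𝓝[Ω] x) (𝓝 L) ∧ 0 < L.det
  inner_eq_zero : ∀ x n, IsOutwardNormal Ω x n → inner ℝ (Φ x - x) n = 0
  eq_self : ∀ x ∈ frontier Ω, (¬ ∃ n, IsOutwardNormal Ω x n) → Φ x = x

namespace IsSlidingMap

variable {Ω : Set Plane} {Φ : Plane → Plane} {x n : Plane}

/-- The mean value inequality on a convex piece of `Ω` makes `Φ - L` Lipschitz with a small
constant, and the bound extends to the closure: a strict derivative up to the boundary. -/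
theorem approximatesLinearOn (hΦ : IsSlidingMap Ω Φ) {L : Plane →L[ℝ] Plane}
    (hL : Tendsto (fderiv ℝ Φ) (𝓝[Ω] x) (𝓝 L)) {ε : ℝ} (hε : 0 < ε)
    (hconv : ∀ r ≤ ε, Convex ℝ (Ω ∩ Metric.ball x r)) {c : ℝ≥0} (hc : 0 < c) :
    ∃ r > 0, r ≤ ε ∧ ApproximatesLinearOn Φ L (closure Ω ∩ Metric.ball x r) c := by
  have hev : ∀ᶠ y in 𝓝[Ω] x, ‖fderiv ℝ Φ y - L‖ < c := by
    have := (tendsto_iff_norm_sub_tendsto_zero.1 hL)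
    exact this.eventually_lt_const hc
  obtain ⟨r, hr, hball⟩ := Metric.eventually_nhds_iff_ball.1 (eventually_nhdsWithin_iff.1 hev)
  refine ⟨min r ε, lt_min hr hε, min_le_right _ _, ?_⟩
  have hlip : LipschitzOnWith c (Φ - ⇑L) (Ω ∩ Metric.ball x (min r ε)) := by
    apply ApproximatesLinearOn.lipschitzOnWith
    intro y hy z hz
    exact (hconv _ (min_le_right _ _)).norm_image_sub_le_of_norm_fderiv_le' (𝕜 := ℝ)
      (fun w hw => (hΦ.differentiableOn w hw.1).differentiableAt (hΦ.isOpen.mem_nhds hw.1))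
      (fun w hw => (hball w (Metric.ball_subset_ball (min_le_left _ _) hw.2) hw.1).le) hz hy
  have hcl : ContinuousOn (Φ - ⇑L) (closure (Ω ∩ Metric.ball x (min r ε))) :=
    (hΦ.continuousOn.mono (closure_mono inter_subset_left)).sub L.continuous.continuousOn
  have := (hlip.closure hcl).mono (s := closure Ω ∩ Metric.ball x (min r ε)) (by
    rw [inter_comm, inter_comm Ω]
    exact Metric.isOpen_ball.inter_closure)
  exact this.approximatesLinearOn

theorem hasFDerivWithinAt (hΦ : IsSlidingMap Ω Φ) (hx : IsOutwardNormal Ω x n)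
    {L : Plane →L[ℝ] Plane} (hL : Tendsto (fderiv ℝ Φ) (𝓝[Ω] x) (𝓝 L)) :
    HasFDerivWithinAt Φ L (closure Ω) x := by
  obtain ⟨ε, hε, hconv⟩ := hx.exists_convex_inter_ball
  have h := hasFDerivWithinAt_closure_of_tendsto_fderiv
    (hΦ.differentiableOn.mono (inter_subset_left (t := Metric.ball x ε))) (hconv ε le_rfl)
    (hΦ.isOpen.inter Metric.isOpen_ball)
    (fun y hy => (hΦ.continuousOn y (closure_mono inter_subset_left hy)).mono
      (inter_subset_left.trans subset_closure))
    (hL.mono_left (nhdsWithin_mono x inter_subset_left))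
  have h2 : HasFDerivWithinAt Φ L (closure Ω ∩ Metric.ball x ε) x := h.mono (by
    rw [inter_comm, inter_comm Ω]
    exact Metric.isOpen_ball.inter_closure)
  exact (hasFDerivWithinAt_inter (Metric.ball_mem_nhds x hε)).1 h2

/-- Near `x` the tangent line stays in the frontier, so the one-sided derivative can be taken along
it in both directions; the normal component of `Φ - x` is identically zero there. -/
theorem hasDerivAt_tangent (hΦ : IsSlidingMap Ω Φ) (hx : IsOutwardNormal Ω x n)
    {L : Plane →L[ℝ] Plane} (hL : Tendsto (fderiv ℝ Φ) (𝓝[Ω] x) (𝓝 L)) :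
    HasDerivAt (fun s : ℝ => Φ (x + s • Plane.rot n)) (L (Plane.rot n)) 0 ∧
      inner ℝ (L (Plane.rot n)) n = 0 := by
  have hpath : HasDerivAt (fun s : ℝ => x + s • Plane.rot n) (Plane.rot n) 0 := by
    simpa using ((hasDerivAt_id (0 : ℝ)).smul_const (Plane.rot n)).const_add x
  have hlim : Tendsto (fun s : ℝ => x + s • Plane.rot n) (𝓝 0) (𝓝 x) := by
    simpa using hpath.continuousAt.tendsto
  have hev : ∀ᶠ s in 𝓝 (0 : ℝ), IsOutwardNormal Ω (x + s • Plane.rot n) n := by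
    filter_upwards [hlim.eventually hx.eventually_of_inner_eq_zero] with s hs
    apply hs
    rw [add_sub_cancel_left, inner_smul_left, Plane.inner_rot, mul_zero]
  have hder : HasDerivAt (fun s : ℝ => Φ (x + s • Plane.rot n)) (L (Plane.rot n)) 0 := by
    set S : Set ℝ := {s | IsOutwardNormal Ω (x + s • Plane.rot n) n} with hS
    have h1 : HasFDerivWithinAt Φ L (closure Ω) (x + (0 : ℝ) • Plane.rot n) := by
      simpa using hΦ.hasFDerivWithinAt hx hL
    have h2 := h1.comp_hasDerivWithinAt (s := S) 0 hpath.hasDerivWithinAt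
      fun s hs => IsOutwardNormal.mem_closure hs
    exact h2.hasDerivAt hev
  refine ⟨hder, ?_⟩
  have h3 : HasDerivAt (fun s : ℝ => inner ℝ (Φ (x + s • Plane.rot n) - x) n)
      (inner ℝ (L (Plane.rot n)) n) 0 := by
    simpa using (hder.sub_const x).inner ℝ (hasDerivAt_const (0 : ℝ) n)
  refine h3.unique ((hasDerivAt_const (0 : ℝ) (0 : ℝ)).congr_of_eventuallyEq ?_)
  filter_upwards [hev] with s hs
  have := hΦ.inner_eq_zero _ _ hs
  rw [← sub_sub, inner_sub_left, inner_smul_left, Plane.inner_rot, mul_zero, sub_zero] at this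
  exact this

/-- The map permutes the boundary points of an edge line with a given normal. -/
theorem tangent_structure (hΦ : IsSlidingMap Ω Φ) (hx : IsOutwardNormal Ω x n) :
    IsOutwardNormal Ω (Φ x) n ∧ (∃ y, IsOutwardNormal Ω y n ∧ Φ y = x) ∧
      (∀ y z, IsOutwardNormal Ω y n → IsOutwardNormal Ω z n → Φ y = x → Φ z = x → y = z) ∧
      ∀ L : Plane →L[ℝ] Plane, Tendsto (fderiv ℝ Φ) (𝓝[Ω] x) (𝓝 L) →
        0 < inner ℝ (L (Plane.rot n)) (Plane.rot n) := by
  set X : ℝ → Plane := fun s => x + s • Plane.rot n with hX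
  have hXc : Continuous X := by fun_prop
  have hXn : ∀ s t, inner ℝ (X s - X t) n = 0 := by
    intro s t
    simp [hX, inner_sub_left, inner_smul_left, Plane.inner_rot]
  have hXadd : ∀ s t, X (s + t) = X s + t • Plane.rot n := by
    intro s t; simp only [hX, add_smul]; abel
  have hX0 : X 0 = x := by simp [hX]
  have honto : ∀ y, inner ℝ (y - x) n = 0 → y = X (inner ℝ (y - x) (Plane.rot n)) := by
    intro y hy
    rw [hX]; dsimp only
    rw [← Plane.eq_smul_rot hx.1 hy]; abel
  -- The whole line is treated at once: `G` may have several components, one for each run of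
  -- boundary points with normal `n`.
  set G : Set ℝ := {s | IsOutwardNormal Ω (X s) n} with hGdef
  have hG : IsOpen G := by
    rw [isOpen_iff_mem_nhds]
    intro s hs
    filter_upwards [hXc.continuousAt.eventually (IsOutwardNormal.eventually_of_inner_eq_zero hs)]
      with t ht
    exact ht (hXn t s)
  have hdist : ∀ s, dist s 0 = dist (X s) x := by
    intro s
    rw [dist_eq_norm, dist_eq_norm, hX]
    simp [norm_smul, Plane.norm_rot hx.1]
  have hGb : Bornology.IsBounded G := by
    obtain ⟨R, hR⟩ := (Metric.isBounded_iff_subset_closedBall x).1 hΦ.isBounded.closure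
    refine (Metric.isBounded_iff_subset_closedBall 0).2 ⟨R, fun s hs => ?_⟩
    rw [Metric.mem_closedBall, hdist]
    exact hR (IsOutwardNormal.mem_closure hs)
  have hclG : ∀ s ∈ closure G, X s ∈ frontier Ω := by
    have : closure G ⊆ X ⁻¹' frontier Ω :=
      closure_minimal (fun s hs => IsOutwardNormal.mem_frontier hs)
        (isClosed_frontier.preimage hXc)
    exact this
  set h : ℝ → ℝ := fun s => inner ℝ (Φ (X s) - x) (Plane.rot n) with hh
  have hcont : ContinuousOn h (closure G) := by
    have h1 : ContinuousOn (fun s => Φ (X s)) (closure G) :=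
      hΦ.continuousOn.comp hXc.continuousOn fun s hs => frontier_subset_closure (hclG s hs)
    exact (h1.sub continuousOn_const).inner continuousOn_const
  -- A normal at such a limit point would be shared by nearby frontier points, hence equal `n`; so
  -- there is none, and the point is fixed.
  have hfix : ∀ s ∈ closure G, s ∉ G → h s = s := by
    intro s hs hsG
    have : ¬ ∃ m, IsOutwardNormal Ω (X s) m := by
      rintro ⟨m, hm⟩
      have hev := hXc.continuousAt.eventually (hm.eventually_of_mem_frontier hΦ.isOpen)
      obtain ⟨t, htG, ht⟩ := ((mem_closure_iff_frequently.1 hs).and_eventually hev).exists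
      have := IsOutwardNormal.unique htG (ht (IsOutwardNormal.mem_frontier htG)).2
      subst this
      exact hsG hm
    rw [hh]; dsimp only
    rw [hΦ.eq_self _ (hclG s hs) this]
    simp [hX, inner_smul_left, Plane.norm_rot hx.1]
  have hder : ∀ s ∈ G, ∀ L : Plane →L[ℝ] Plane, Tendsto (fderiv ℝ Φ) (𝓝[Ω] (X s)) (𝓝 L) →
      HasDerivAt h (inner ℝ (L (Plane.rot n)) (Plane.rot n)) s ∧
        inner ℝ (L (Plane.rot n)) n = 0 := by
    intro s hs L hL
    obtain ⟨h1, h2⟩ := hΦ.hasDerivAt_tangent hs hL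
    refine ⟨?_, h2⟩
    have h3 : HasDerivAt (fun t => h (s + t)) (inner ℝ (L (Plane.rot n)) (Plane.rot n)) 0 := by
      simp only [hh, hXadd]
      simpa using (h1.sub_const x).inner ℝ (hasDerivAt_const (0 : ℝ) (Plane.rot n))
    have h4 : HasDerivAt (fun t => t - s) 1 s := (hasDerivAt_id s).sub_const s
    have h5 := HasDerivAt.comp (h₂ := fun t => h (s + t)) (h := fun t => t - s) s
      (by simpa using h3) h4
    simpa [Function.comp_def] using h5
  have hne : ∀ s ∈ G, DifferentiableAt ℝ h s ∧ deriv h s ≠ 0 := by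
    intro s hs
    obtain ⟨L, hL, hdet⟩ := hΦ.exists_tendsto _ (IsOutwardNormal.mem_closure hs)
    obtain ⟨h1, h2⟩ := hder s hs L hL
    refine ⟨h1.differentiableAt, ?_⟩
    rw [h1.deriv]
    intro h0
    rw [Plane.det_eq L hx.1, h2, h0] at hdet
    simp at hdet
  obtain ⟨hbij, hpos⟩ := bijOn_of_deriv_ne_zero_of_fixed hG hGb hcont hfix
    (fun s hs => (hne s hs).1.hasDerivAt) (fun s hs => (hne s hs).2)
  have h0G : (0 : ℝ) ∈ G := by rw [hGdef, mem_ofPred_eq, hX0]; exact hx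
  have hΦX : ∀ s ∈ G, Φ (X s) = X (h s) := by
    intro s hs
    apply honto
    have h1 := hΦ.inner_eq_zero _ _ hs
    have h2 := hXn s 0
    rw [hX0] at h2
    rw [inner_sub_left] at *
    linarith
  refine ⟨?_, ?_, ?_, ?_⟩
  · have := hbij.mapsTo h0G
    rw [← hX0, hΦX 0 h0G]
    exact this
  · obtain ⟨s, hs, hs0⟩ := hbij.surjOn h0G
    exact ⟨X s, hs, by rw [hΦX s hs, hs0, hX0]⟩
  · have hparam : ∀ y, IsOutwardNormal Ω y n → Φ y = x → ∃ s ∈ G, X s = y ∧ h s = 0 := by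
      intro y hy hyx
      have h1 := hΦ.inner_eq_zero _ _ hy
      rw [hyx, ← neg_sub, inner_neg_left, neg_eq_zero] at h1
      have h2 := honto y h1
      refine ⟨_, ?_, h2.symm, ?_⟩
      · rw [hGdef, mem_ofPred_eq, ← h2]; exact hy
      · rw [hh]; dsimp only
        rw [← h2, hyx, sub_self, inner_zero_left]
    intro y z hy hz hyx hzx
    obtain ⟨s, hs, rfl, hs0⟩ := hparam y hy hyx
    obtain ⟨t, ht, rfl, ht0⟩ := hparam z hz hzx
    rw [hbij.injOn hs ht (hs0.trans ht0.symm)]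
  · intro L hL
    have h1 := (hder 0 h0G L (by rwa [hX0])).1
    rw [← h1.deriv]
    exact hpos 0 h0G

theorem mapsTo_frontier (hΦ : IsSlidingMap Ω Φ) : MapsTo Φ (frontier Ω) (frontier Ω) := by
  intro x hx
  by_cases h : ∃ n, IsOutwardNormal Ω x n
  · obtain ⟨n, hn⟩ := h
    exact (hΦ.tangent_structure hn).1.mem_frontier
  · rwa [hΦ.eq_self x hx h]

/-- A boundary point with outward normal `n` has a single boundary preimage, with the same
normal. -/
theorem exists_frontier_preimage (hΦ : IsSlidingMap Ω Φ) (hx : IsOutwardNormal Ω x n) :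
    ∃ y, IsOutwardNormal Ω y n ∧ Φ y = x ∧ ∀ z ∈ frontier Ω, Φ z = x → z = y := by
  obtain ⟨-, ⟨y, hy, hyx⟩, hinj, -⟩ := hΦ.tangent_structure hx
  refine ⟨y, hy, hyx, fun z hz hzx => ?_⟩
  by_cases h : ∃ m, IsOutwardNormal Ω z m
  · obtain ⟨m, hm⟩ := h
    have h1 := (hΦ.tangent_structure hm).1
    rw [hzx] at h1
    rw [← hx.unique h1] at hm
    exact hinj z y hm hy hzx hyx
  · have := hΦ.eq_self z hz h
    rw [this] at hzx
    exact absurd ⟨n, hzx ▸ hx⟩ h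

end IsSlidingMap

/-! ### Fibres and local homeomorphisms -/

/-- If a map coincides near each point of a fibre in a compact set `C` with a homeomorphism, then
the nearby fibres are obtained by transporting that fibre by the inverse homeomorphisms. -/
theorem finite_fiber_and_eventually_ncard_eq {X Y : Type*} [TopologicalSpace X] [T2Space X]
    [TopologicalSpace Y] [T2Space Y] {C Ω : Set X} (hC : IsCompact C) (hΩ : Ω ⊆ C) {f : X → Y}
    (hf : ContinuousOn f C) {y₀ : Y} (u : X → X ≃ₜ Y)
    (hu : ∀ x ∈ C, f x = y₀ → ∃ U ∈ 𝓝 x, EqOn f (u x) (C ∩ U)) :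
    {x ∈ C | f x = y₀}.Finite ∧ ∀ᶠ y in 𝓝 y₀,
      {z ∈ Ω | f z = y}.ncard = {x ∈ C | f x = y₀ ∧ (u x).symm y ∈ Ω}.ncard := by
  set Q : Set X := {x ∈ C | f x = y₀} with hQ
  choose! U hU heq using hu
  -- The fibre is compact, and injectivity of `u x` isolates each of its points.
  have hQfin : Q.Finite := by
    have hQc : IsCompact Q := by
      obtain ⟨t, ht, hteq⟩ := continuousOn_iff_isClosed.1 hf {y₀} isClosed_singleton
      have : Q = t ∩ C := by
        rw [← hteq]; ext x; simp [hQ, and_comm]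
      rw [this]
      exact hC.inter_left ht
    obtain ⟨t, htQ, ht⟩ := hQc.elim_nhds_subcover U fun x hx => hU x hx.1 hx.2
    refine t.finite_toSet.subset fun z hz => ?_
    obtain ⟨x, hx, hzx⟩ := mem_iUnion₂.1 (ht hz)
    obtain ⟨hxC, hxy⟩ := htQ x hx
    have h1 := heq x hxC hxy ⟨hz.1, hzx⟩
    have h2 := heq x hxC hxy ⟨hxC, mem_of_mem_nhds (hU x hxC hxy)⟩
    have : z = x := (u x).injective (by rw [← h1, ← h2, hz.2, hxy])
    rw [this]; exact hx
  refine ⟨hQfin, ?_⟩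
  obtain ⟨V, hV, hVd⟩ := hQfin.t2_separation
  set W : X → Set X := fun x => V x ∩ interior (U x) with hW
  have hWo : ∀ x, IsOpen (W x) := fun x => (hV x).2.inter isOpen_interior
  have hev1 : ∀ᶠ y in 𝓝 y₀, ∀ x ∈ Q, (u x).symm y ∈ W x := by
    refine (hQfin.eventually_all).2 fun x hx => ?_
    have h2 := heq x hx.1 hx.2 ⟨hx.1, mem_of_mem_nhds (hU x hx.1 hx.2)⟩
    have h3 : (u x).symm y₀ = x := by rw [← hx.2, h2, Homeomorph.symm_apply_apply]
    refine (u x).symm.continuous.continuousAt.eventually ((hWo x).mem_nhds ?_)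
    rw [h3]
    exact ⟨(hV x).1, mem_interior_iff_mem_nhds.2 (hU x hx.1 hx.2)⟩
  -- The part of `C` away from the fibre has compact image missing `y₀`, so no new preimages appear
  -- from afar.
  have hev2 : ∀ᶠ y in 𝓝 y₀, ∀ z ∈ C, f z = y → ∃ x ∈ Q, z ∈ W x := by
    have hcomp : IsCompact (f '' (C \ ⋃ x ∈ Q, W x)) :=
      (hC.diff (isOpen_biUnion fun x _ => hWo x)).image_of_continuousOn
        (hf.mono sdiff_subset)
    have hnot : y₀ ∉ f '' (C \ ⋃ x ∈ Q, W x) := by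
      rintro ⟨z, hz, hzy⟩
      exact hz.2 (mem_biUnion (⟨hz.1, hzy⟩ : z ∈ Q)
        ⟨(hV z).1, mem_interior_iff_mem_nhds.2 (hU z hz.1 hzy)⟩)
    filter_upwards [hcomp.isClosed.isOpen_compl.mem_nhds hnot] with y hy z hz hzy
    by_contra hcon
    refine hy ⟨z, ⟨hz, fun hmem => hcon ?_⟩, hzy⟩
    obtain ⟨x, hx, hzx⟩ := mem_iUnion₂.1 hmem
    exact ⟨x, hx, hzx⟩
  filter_upwards [hev1, hev2] with y hy1 hy2
  have himage : {z ∈ Ω | f z = y} =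
      (fun x => (u x).symm y) '' {x ∈ C | f x = y₀ ∧ (u x).symm y ∈ Ω} := by
    ext z
    constructor
    · rintro ⟨hz, hzy⟩
      obtain ⟨x, hx, hzx⟩ := hy2 z (hΩ hz) hzy
      have h1 := heq x hx.1 hx.2 ⟨hΩ hz, interior_subset hzx.2⟩
      have h2 : (u x).symm y = z := by rw [← hzy, h1, Homeomorph.symm_apply_apply]
      exact ⟨x, ⟨hx.1, hx.2, by rwa [h2]⟩, h2⟩
    · rintro ⟨x, ⟨hxC, hxy, hxΩ⟩, rfl⟩
      refine ⟨hxΩ, ?_⟩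
      have h1 := heq x hxC hxy ⟨hΩ hxΩ, interior_subset (hy1 x ⟨hxC, hxy⟩).2⟩
      exact h1.trans ((u x).apply_symm_apply y)
  rw [himage]
  refine InjOn.ncard_image ?_
  rintro x ⟨hx, hxy, -⟩ x' ⟨hx', hxy', -⟩ h
  by_contra hne
  have hd := hVd (⟨hx, hxy⟩ : x ∈ Q) (⟨hx', hxy'⟩ : x' ∈ Q) hne
  have h1 := (hy1 x ⟨hx, hxy⟩).1
  have h2 := (hy1 x' ⟨hx', hxy'⟩).1
  dsimp only at h
  rw [← h] at h2
  exact disjoint_left.1 hd h1 h2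

namespace IsSlidingMap

variable {Ω : Set Plane} {Φ : Plane → Plane} {x n : Plane}

/-- `Φ` is controlled only on the closure of `Ω`; its small Lipschitz deviation from `L` extends to
the plane, and a small perturbation of an invertible map is a homeomorphism. The bound `d` allows a
further smallness requirement. -/
theorem exists_homeomorph (hΦ : IsSlidingMap Ω Φ) {L : Plane →L[ℝ] Plane}
    (hL : Tendsto (fderiv ℝ Φ) (𝓝[Ω] x) (𝓝 L)) (hdet : L.det ≠ 0) {ε : ℝ} (hε : 0 < ε)
    (hconv : ∀ r ≤ ε, Convex ℝ (Ω ∩ Metric.ball x r)) {d : ℝ≥0} (hd : 0 < d) :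
    ∃ u : Plane ≃ₜ Plane, ∃ c < d, ∃ r > 0,
      ApproximatesLinearOn Φ L (closure Ω ∩ Metric.ball x r) c ∧
      EqOn Φ u (closure Ω ∩ Metric.ball x r) := by
  set e := L.toContinuousLinearEquivOfDetNeZero hdet with he
  have heL : (e : Plane →L[ℝ] Plane) = L := L.coe_toContinuousLinearEquivOfDetNeZero hdet
  have hpos : 0 < ‖(e.symm : Plane →L[ℝ] Plane)‖₊⁻¹ := by
    rw [inv_pos]
    exact e.symm.norm_pos
  have hlim : Tendsto (fun c : ℝ≥0 => lipschitzExtensionConstant Plane * c) (𝓝 0) (𝓝 0) := by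
    have : Tendsto (fun c : ℝ≥0 => lipschitzExtensionConstant Plane * c) (𝓝 0)
        (𝓝 (lipschitzExtensionConstant Plane * 0)) := Continuous.tendsto (by fun_prop) 0
    rwa [mul_zero] at this
  have hlim' := (hlim.eventually_lt_const hpos).and (eventually_lt_nhds hd)
  obtain ⟨c, ⟨hc1, hc2⟩, hc0⟩ :=
    ((hlim'.filter_mono nhdsWithin_le_nhds).and (self_mem_nhdsWithin (s := Ioi 0))).exists
  obtain ⟨r, hr, -, happ⟩ := hΦ.approximatesLinearOn hL hε hconv hc0
  have happ' := happ
  rw [← heL] at happ'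
  obtain ⟨u, hu⟩ := happ'.exists_homeomorph_extension (Or.inr hc1)
  exact ⟨u, c, hc2, r, hr, happ, hu⟩

theorem exists_homeomorph_of_mem (hΦ : IsSlidingMap Ω Φ) (hx : x ∈ Ω) :
    ∃ u : Plane ≃ₜ Plane, ∃ U ∈ 𝓝 x, EqOn Φ u (closure Ω ∩ U) := by
  obtain ⟨L, hL, hdet⟩ := hΦ.exists_tendsto x (subset_closure hx)
  obtain ⟨ε, hε, hball⟩ := Metric.isOpen_iff.1 hΦ.isOpen x hx
  obtain ⟨u, -, -, r, hr, -, hu⟩ := hΦ.exists_homeomorph hL hdet.ne' hε (fun r hr => by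
    rw [inter_eq_right.2 ((Metric.ball_subset_ball hr).trans hball)]
    exact convex_ball x r) zero_lt_one
  exact ⟨u, _, Metric.ball_mem_nhds x hr, hu⟩

/-- At a boundary point with outward normal, the map extends to a local homeomorphism which
respects `Ω`. -/
theorem exists_homeomorph_of_isOutwardNormal (hΦ : IsSlidingMap Ω Φ) (hx : IsOutwardNormal Ω x n) :
    ∃ u : Plane ≃ₜ Plane, (∃ U ∈ 𝓝 x, EqOn Φ u (closure Ω ∩ U)) ∧
      ∀ᶠ y in 𝓝 (Φ x), (u.symm y ∈ Ω ↔ y ∈ Ω) := by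
  obtain ⟨L, hL, hdet⟩ := hΦ.exists_tendsto x hx.mem_closure
  obtain ⟨hy₀, -, -, hpos⟩ := hΦ.tangent_structure hx
  have hLn := (hΦ.hasDerivAt_tangent hx hL).2
  have hLτ := hpos L hL
  -- The Jacobian and the tangential stretch are both positive, so the normal stretch is too; it
  -- then serves as the bound on the error `c`.
  have hd : 0 < inner ℝ (L n) n := by
    rw [Plane.det_eq L hx.1, hLn, zero_mul, sub_zero] at hdet
    exact pos_of_mul_pos_right hdet hLτ.le
  obtain ⟨ε, hε, hconv⟩ := hx.exists_convex_inter_ball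
  obtain ⟨u, c, hc, r, hr, happ, hu⟩ := hΦ.exists_homeomorph hL hdet.ne' hε hconv
    (d := ⟨inner ℝ (L n) n, hd.le⟩) hd
  have hc' : (c : ℝ) < inner ℝ (L n) n := hc
  refine ⟨u, ⟨_, Metric.ball_mem_nhds x hr, hu⟩, ?_⟩
  have hux : u x = Φ x := (hu ⟨hx.mem_closure, Metric.mem_ball_self hr⟩).symm
  have hsx : u.symm (Φ x) = x := by rw [← hux, u.symm_apply_apply]
  have hsc : Tendsto u.symm (𝓝 (Φ x)) (𝓝 x) := by
    have := u.symm.continuous.tendsto (Φ x)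
    rwa [hsx] at this
  -- points of `Ω` near `x` are sent to the inner side of the boundary line
  have hin : ∀ᶠ z in 𝓝 x, z ∈ Ω → inner ℝ (Φ z - Φ x) n < 0 := by
    have hproj : Tendsto (fun z : Plane => z - (inner ℝ (z - x) n : ℝ) • n) (𝓝 x) (𝓝 x) := by
      have h : Continuous fun z : Plane => z - (inner ℝ (z - x) n : ℝ) • n := by fun_prop
      simpa using h.tendsto x
    filter_upwards [hx.eventually_mem_iff, hproj.eventually hx.eventually_of_inner_eq_zero,
      hproj.eventually (Metric.ball_mem_nhds x hr), Metric.ball_mem_nhds x hr]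
      with z hz1 hz2 hz3 hz4 hzΩ
    set s : ℝ := inner ℝ (z - x) n with hs
    have hs0 : s < 0 := hz1.1 hzΩ
    -- The foot of `z` on the edge line, which `Φ` keeps on that line. The height of `Φ z` is then
    -- at most `s * (inner ℝ (L n) n - c)`, negative because `s < 0`.
    set z' := z - s • n with hz'
    have hz'x : inner ℝ (z' - x) n = 0 := by
      have : z' - x = (z - x) - s • n := by rw [hz']; abel
      rw [this, inner_sub_left, inner_smul_left, hx.inner_self, ← hs, RCLike.conj_to_real,
        mul_one, sub_self]
    have hnz' := hz2 hz'x
    have h1 := hΦ.inner_eq_zero _ _ hnz'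
    have h2 := hΦ.inner_eq_zero _ _ hx
    have h3 := happ z ⟨subset_closure hzΩ, hz4⟩ z' ⟨hnz'.mem_closure, hz3⟩
    have hzz : z - z' = s • n := by rw [hz']; abel
    rw [hzz, map_smul, norm_smul, hx.1, mul_one, Real.norm_of_nonpos hs0.le] at h3
    have h4 := real_inner_le_norm (Φ z - Φ z' - s • L n) n
    rw [hx.1, mul_one] at h4
    replace h4 := h4.trans h3
    simp only [inner_sub_left, inner_smul_left, RCLike.conj_to_real] at h1 h2 h4 hz'x ⊢
    nlinarith
  have hin' : ∀ᶠ y in 𝓝 (Φ x), u.symm y ∈ Ω → y ∈ Ω := by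
    filter_upwards [hsc.eventually hin, hy₀.eventually_mem_iff,
      hsc.eventually (Metric.ball_mem_nhds x hr)] with y h1 h2 h3 h4
    have h5 := hu ⟨subset_closure h4, h3⟩
    rw [u.apply_symm_apply] at h5
    rw [h2, ← h5]
    exact h1 h4
  obtain ⟨ε', hε', hconv'⟩ := hy₀.exists_convex_inter_ball
  obtain ⟨δ₀, hδ₀, hball⟩ := Metric.eventually_nhds_iff_ball.1
    (hin'.and (hsc.eventually (Metric.ball_mem_nhds x hr)))
  set δ := min δ₀ ε' with hδdef
  have hδ : 0 < δ := lt_min hδ₀ hε'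
  -- Converse inclusion: the pulled-back half-disk is connected and avoids the frontier, which `Φ`
  -- preserves, so it lies on one side; it contains points of `Ω` near `x`.
  have hpre : IsPreconnected (u.symm '' (Ω ∩ Metric.ball (Φ x) δ)) :=
    ((hconv' δ (min_le_right _ _)).isPreconnected).image _ u.symm.continuous.continuousOn
  have hdisj : Disjoint (u.symm '' (Ω ∩ Metric.ball (Φ x) δ)) (frontier Ω) := by
    rw [disjoint_left]
    rintro _ ⟨y, ⟨hyΩ, hyb⟩, rfl⟩ hfr
    have h1 := hu ⟨frontier_subset_closure hfr,
      (hball y (Metric.ball_subset_ball (min_le_left _ _) hyb)).2⟩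
    rw [u.apply_symm_apply] at h1
    have h2 := hΦ.mapsTo_frontier hfr
    rw [h1, hΦ.isOpen.frontier_eq] at h2
    exact h2.2 hyΩ
  have hsub : u.symm '' (Ω ∩ Metric.ball (Φ x) δ) ⊆ Ω := by
    refine (hpre.subset_or_subset_compl_of_disjoint_frontier hdisj).resolve_right fun hcompl => ?_
    have hux' : Tendsto u (𝓝 x) (𝓝 (Φ x)) := by
      have := u.continuous.tendsto x
      rwa [hux] at this
    obtain ⟨z, hzΩ, hz⟩ := ((mem_closure_iff_frequently.1 hx.mem_closure).and_eventually
      (hux'.eventually (hin'.and (Metric.ball_mem_nhds (Φ x) hδ)))).exists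
    rw [u.symm_apply_apply] at hz
    have : u.symm (u z) ∈ Ωᶜ := hcompl (mem_image_of_mem _ ⟨hz.1 hzΩ, hz.2⟩)
    rw [u.symm_apply_apply] at this
    exact this hzΩ
  filter_upwards [hin', Metric.ball_mem_nhds (Φ x) hδ] with y hy1 hy2
  exact ⟨hy1, fun hy => hsub (mem_image_of_mem _ ⟨hy, hy2⟩)⟩

/-! ### The preimage count and bijectivity -/

open Classical in
/-- The number of preimages in `Ω`, diminished by one in `Ω`. -/
noncomputable def excess (Ω : Set Plane) (Φ : Plane → Plane) (y : Plane) : ℤ :=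
  ({z ∈ Ω | Φ z = y}.ncard : ℤ) - if y ∈ Ω then 1 else 0

/-- Interior preimages persist. Over an edge point there is one further preimage on the boundary,
which moves into `Ω` exactly when `y` does, matching the jump of the indicator; off the frontier no
boundary point lies in the fibre. -/
theorem eventually_excess_eq (hΦ : IsSlidingMap Ω Φ) {y₀ : Plane}
    (hy₀ : y₀ ∈ frontier Ω → ∃ n, IsOutwardNormal Ω y₀ n) :
    {z ∈ Ω | Φ z = y₀}.Finite ∧ ∀ᶠ y in 𝓝 y₀, excess Ω Φ y = excess Ω Φ y₀ := by
  classical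
  have hcompact : IsCompact (closure Ω) := hΦ.isBounded.isCompact_closure
  have hΩfr : ∀ x ∈ closure Ω, x ∉ frontier Ω → x ∈ Ω := by
    intro x hx hfr
    rw [hΦ.isOpen.frontier_eq] at hfr
    by_contra h
    exact hfr ⟨hx, h⟩
  have hloc : ∀ x : Plane, ∃ u : Plane ≃ₜ Plane, x ∈ closure Ω → Φ x = y₀ →
      (∃ U ∈ 𝓝 x, EqOn Φ u (closure Ω ∩ U)) ∧
        (x ∉ Ω → ∀ᶠ y in 𝓝 y₀, (u.symm y ∈ Ω ↔ y ∈ Ω)) := by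
    intro x
    by_cases hx : x ∈ closure Ω ∧ Φ x = y₀
    · by_cases hxΩ : x ∈ Ω
      · obtain ⟨u, hu⟩ := hΦ.exists_homeomorph_of_mem hxΩ
        exact ⟨u, fun _ _ => ⟨hu, fun h => absurd hxΩ h⟩⟩
      · have hxfr : x ∈ frontier Ω := by
          by_contra h
          exact hxΩ (hΩfr x hx.1 h)
        have hn : ∃ n, IsOutwardNormal Ω x n := by
          by_contra h
          have h1 := hΦ.eq_self x hxfr h
          have h2 : x = y₀ := h1.symm.trans hx.2
          subst h2
          exact h (hy₀ hxfr)
        obtain ⟨n, hn⟩ := hn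
        obtain ⟨u, hu, hev⟩ := hΦ.exists_homeomorph_of_isOutwardNormal hn
        rw [hx.2] at hev
        exact ⟨u, fun _ _ => ⟨hu, fun _ => hev⟩⟩
    · exact ⟨Homeomorph.refl _, fun h1 h2 => absurd ⟨h1, h2⟩ hx⟩
  choose u hu using hloc
  obtain ⟨hfin, hev⟩ := finite_fiber_and_eventually_ncard_eq hcompact subset_closure
    hΦ.continuousOn u fun x hx hxy => (hu x hx hxy).1
  have hPfin : {z ∈ Ω | Φ z = y₀}.Finite := hfin.subset fun z hz => ⟨subset_closure hz.1, hz.2⟩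
  refine ⟨hPfin, ?_⟩
  have hint : ∀ᶠ y in 𝓝 y₀, ∀ x ∈ {z ∈ Ω | Φ z = y₀}, (u x).symm y ∈ Ω := by
    refine (hPfin.eventually_all).2 fun x hx => ?_
    obtain ⟨U, hU, heq⟩ := (hu x (subset_closure hx.1) hx.2).1
    have h1 : (u x).symm y₀ = x := by
      rw [← hx.2, heq ⟨subset_closure hx.1, mem_of_mem_nhds hU⟩, Homeomorph.symm_apply_apply]
    refine (u x).symm.continuous.continuousAt.eventually (hΦ.isOpen.mem_nhds ?_)
    rw [h1]; exact hx.1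
  by_cases hfr : y₀ ∈ frontier Ω
  · obtain ⟨n, hn⟩ := hy₀ hfr
    obtain ⟨x₀, hx₀, hx₀y, huniq⟩ := hΦ.exists_frontier_preimage hn
    filter_upwards [hev, hint, (hu x₀ hx₀.mem_closure hx₀y).2 hx₀.notMem] with y h1 h2 h3
    unfold excess
    rw [h1, if_neg hn.notMem]
    by_cases hy : y ∈ Ω
    · have : {x ∈ closure Ω | Φ x = y₀ ∧ (u x).symm y ∈ Ω} = insert x₀ {z ∈ Ω | Φ z = y₀} := by
        ext z
        constructor
        · rintro ⟨hz, hzy, -⟩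
          by_cases hzfr : z ∈ frontier Ω
          · exact Or.inl (huniq z hzfr hzy)
          · exact Or.inr ⟨hΩfr z hz hzfr, hzy⟩
        · rintro (rfl | hz)
          · exact ⟨hx₀.mem_closure, hx₀y, h3.2 hy⟩
          · exact ⟨subset_closure hz.1, hz.2, h2 z hz⟩
      rw [this, ncard_insert_of_notMem (fun h => hx₀.notMem h.1) hPfin, if_pos hy]
      push_cast; ring
    · have : {x ∈ closure Ω | Φ x = y₀ ∧ (u x).symm y ∈ Ω} = {z ∈ Ω | Φ z = y₀} := by
        ext z
        constructor
        · rintro ⟨hz, hzy, hzu⟩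
          by_cases hzfr : z ∈ frontier Ω
          · rw [huniq z hzfr hzy] at hzu
            exact absurd (h3.1 hzu) hy
          · exact ⟨hΩfr z hz hzfr, hzy⟩
        · intro hz
          exact ⟨subset_closure hz.1, hz.2, h2 z hz⟩
      rw [this, if_neg hy]
  · have hmem : ∀ᶠ y in 𝓝 y₀, (y ∈ Ω ↔ y₀ ∈ Ω) := by
      by_cases hy : y₀ ∈ Ω
      · filter_upwards [hΦ.isOpen.mem_nhds hy] with y h
        exact ⟨fun _ => hy, fun _ => h⟩
      · have : y₀ ∉ closure Ω := fun h => hy (hΩfr y₀ h hfr)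
        filter_upwards [isClosed_closure.isOpen_compl.mem_nhds this] with y h
        exact ⟨fun h' => absurd (subset_closure h') h, fun h' => absurd h' hy⟩
    filter_upwards [hev, hint, hmem] with y h1 h2 h3
    have : {x ∈ closure Ω | Φ x = y₀ ∧ (u x).symm y ∈ Ω} = {z ∈ Ω | Φ z = y₀} := by
      ext z
      constructor
      · rintro ⟨hz, hzy, -⟩
        refine ⟨hΩfr z hz fun hzfr => hfr ?_, hzy⟩
        rw [← hzy]
        exact hΦ.mapsTo_frontier hzfr
      · intro hz
        exact ⟨subset_closure hz.1, hz.2, h2 z hz⟩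
    unfold excess
    rw [h1, this]
    simp only [h3]

/-- Off the finitely many boundary points without normal, the number of preimages is one in `Ω` and
zero elsewhere. -/
theorem excess_eq_zero (hΦ : IsSlidingMap Ω Φ)
    (hfin : {x ∈ frontier Ω | ¬ ∃ n, IsOutwardNormal Ω x n}.Finite) {y : Plane}
    (hy : y ∈ frontier Ω → ∃ n, IsOutwardNormal Ω y n) : excess Ω Φ y = 0 := by
  set B := {x ∈ frontier Ω | ¬ ∃ n, IsOutwardNormal Ω x n} with hB
  have hBc : ∀ z, z ∈ Bᶜ ↔ (z ∈ frontier Ω → ∃ n, IsOutwardNormal Ω z n) := by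
    intro z; simp [hB]
  have hconn : IsPreconnected Bᶜ := by
    refine (hfin.countable.isPathConnected_compl_of_one_lt_rank ?_).isConnected.isPreconnected
    rw [← Module.finrank_eq_rank, finrank_euclideanSpace_fin]
    norm_num
  have hcont : ContinuousOn (excess Ω Φ) Bᶜ := by
    intro z hz
    apply ContinuousAt.continuousWithinAt
    have := (hΦ.eventually_excess_eq ((hBc z).1 hz)).2
    exact tendsto_nhds_of_eventually_eq this
  have hcompact : IsCompact (closure Ω) := hΦ.isBounded.isCompact_closure
  have hbdd : Bornology.IsBounded (closure Ω ∪ Φ '' closure Ω) :=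
    hcompact.isBounded.union (hcompact.image_of_continuousOn hΦ.continuousOn).isBounded
  -- A base point far away, where both the count and the indicator vanish.
  obtain ⟨z, hz⟩ : ∃ z, z ∉ closure Ω ∪ Φ '' closure Ω := by
    by_contra! h
    exact NormedSpace.unbounded_univ ℝ Plane (hbdd.subset fun z _ => h z)
  rw [mem_union, not_or] at hz
  have hzB : z ∈ Bᶜ := (hBc z).2 fun h => absurd (frontier_subset_closure h) hz.1
  rw [hconn.constant hcont ((hBc y).2 hy) hzB]
  have hempty : {w ∈ Ω | Φ w = z} = ∅ := by
    rw [eq_empty_iff_forall_notMem]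
    rintro w ⟨hw, hwz⟩
    exact hz.2 ⟨w, subset_closure hw, hwz⟩
  unfold excess
  rw [hempty, if_neg fun h => hz.1 (subset_closure h)]
  simp

theorem eventually_nhds_exists_preimage (hΦ : IsSlidingMap Ω Φ) (hx : x ∈ Ω) {U : Set Plane}
    (hU : U ∈ 𝓝 x) : ∀ᶠ y in 𝓝 (Φ x), ∃ z ∈ Ω ∩ U, Φ z = y := by
  obtain ⟨u, W, hW, heq⟩ := hΦ.exists_homeomorph_of_mem hx
  have hux : u x = Φ x := (heq ⟨subset_closure hx, mem_of_mem_nhds hW⟩).symm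
  have hsc : Tendsto u.symm (𝓝 (Φ x)) (𝓝 x) := by
    have := u.symm.continuous.tendsto (Φ x)
    rwa [← hux, u.symm_apply_apply, hux] at this
  filter_upwards [hsc.eventually hW, hsc.eventually hU, hsc.eventually (hΦ.isOpen.mem_nhds hx)]
    with y h1 h2 h3
  exact ⟨u.symm y, ⟨h3, h2⟩, (heq ⟨subset_closure h3, h1⟩).trans (u.apply_symm_apply y)⟩

/-- The count is known only off the exceptional set, and openness of `Φ` covers the rest: an
interior point sent to an exceptional value would put a punctured neighbourhood of it in `Ω`,
against `hiso`, and two preimages of any value would give two preimages of nearby ordinary values.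
-/
theorem bijOn (hΦ : IsSlidingMap Ω Φ)
    (hfin : {x ∈ frontier Ω | ¬ ∃ n, IsOutwardNormal Ω x n}.Finite)
    (hiso : ∀ x ∈ frontier Ω, ¬ ∀ᶠ y in 𝓝 x, y = x ∨ y ∈ Ω) : BijOn Φ Ω Ω := by
  classical
  set B := {x ∈ frontier Ω | ¬ ∃ n, IsOutwardNormal Ω x n} with hB
  have hgood : ∀ y : Plane, ∀ᶠ z in 𝓝 y, z ≠ y → z ∉ B := by
    intro y
    have : (B \ {y})ᶜ ∈ 𝓝 y := (hfin.subset sdiff_subset).isClosed.isOpen_compl.mem_nhds (by simp)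
    filter_upwards [this] with z hz hne hzB
    exact hz ⟨hzB, hne⟩
  have hcard : ∀ y ∉ B, {z ∈ Ω | Φ z = y}.Finite ∧
      ({z ∈ Ω | Φ z = y}.ncard : ℤ) = if y ∈ Ω then 1 else 0 := by
    intro y hy
    have hy' : y ∈ frontier Ω → ∃ n, IsOutwardNormal Ω y n := by
      intro h
      by_contra hcon
      exact hy ⟨h, hcon⟩
    refine ⟨(hΦ.eventually_excess_eq hy').1, ?_⟩
    have := hΦ.excess_eq_zero hfin hy'
    unfold excess at this
    rw [sub_eq_zero] at this
    convert this
  have hmem : ∀ z ∈ Ω, Φ z ∉ B → Φ z ∈ Ω := by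
    intro z hz hzB
    obtain ⟨h1, h2⟩ := hcard _ hzB
    by_contra hcon
    rw [if_neg hcon, Nat.cast_eq_zero, ncard_eq_zero h1] at h2
    have : z ∈ {w ∈ Ω | Φ w = Φ z} := ⟨hz, rfl⟩
    rw [h2] at this
    exact this
  refine ⟨?_, ?_, ?_⟩
  · intro x hx
    by_contra hcon
    have hev : ∀ᶠ y in 𝓝 (Φ x), y = Φ x ∨ y ∈ Ω := by
      filter_upwards [hΦ.eventually_nhds_exists_preimage hx univ_mem, hgood (Φ x)] with y h1 h2
      obtain ⟨z, hz, rfl⟩ := h1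
      by_cases hne : Φ z = Φ x
      · exact Or.inl hne
      · exact Or.inr (hmem z hz.1 (h2 hne))
    by_cases hfr : Φ x ∈ frontier Ω
    · exact hiso _ hfr hev
    · exact hcon (hmem x hx fun h => hfr h.1)
  · intro x hx x' hx' heq
    by_contra hne
    obtain ⟨U, U', hU, hU', hxU, hxU', hd⟩ := t2_separation hne
    have h1 := hΦ.eventually_nhds_exists_preimage hx (hU.mem_nhds hxU)
    have h2 := hΦ.eventually_nhds_exists_preimage hx' (hU'.mem_nhds hxU')
    rw [← heq] at h2
    obtain ⟨y, ⟨⟨z, hz, hzy⟩, ⟨z', hz', hzy'⟩, hyB⟩, hyne⟩ :=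
      (((h1.and (h2.and (hgood (Φ x)))).filter_mono nhdsWithin_le_nhds).and
        (self_mem_nhdsWithin (s := {Φ x}ᶜ))).exists
    obtain ⟨hf, hc⟩ := hcard y (hyB hyne)
    have hle : {w ∈ Ω | Φ w = y}.ncard ≤ 1 := by
      have : ({w ∈ Ω | Φ w = y}.ncard : ℤ) ≤ 1 := by
        rw [hc]; split_ifs <;> norm_num
      exact_mod_cast this
    have := (ncard_le_one hf).1 hle z ⟨hz.1, hzy⟩ z' ⟨hz'.1, hzy'⟩
    subst this
    exact disjoint_left.1 hd hz.2 hz'.2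
  · intro y hy
    have hyB : y ∉ B := by
      intro h
      have := h.1
      rw [hΦ.isOpen.frontier_eq] at this
      exact this.2 hy
    obtain ⟨hf, hc⟩ := hcard y hyB
    rw [if_pos hy] at hc
    have hne : {z ∈ Ω | Φ z = y}.Nonempty := by
      rw [← ncard_pos hf]
      omega
    obtain ⟨z, hz, hzy⟩ := hne
    exact ⟨z, hz, hzy⟩

end IsSlidingMap

/-! ### Application to regular polytopes -/

/-- Otherwise the frontier near `x` is the single point `x`, hence lies in a line, so `x` has an
outward normal; but moving along it leaves `Ω`. -/
theorem IsRegularPolytope.not_eventually_eq_or_mem {Ω : Set Plane} (hΩ : IsRegularPolytope Ω)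
    {x : Plane} (hx : x ∈ frontier Ω) : ¬ ∀ᶠ y in 𝓝 x, y = x ∨ y ∈ Ω := by
  intro hev
  have hfr : ∀ z ∈ frontier Ω, z ∉ Ω := fun z hz => by
    rw [hΩ.isOpen.frontier_eq] at hz
    exact hz.2
  have hn : ∃ n, IsOutwardNormal Ω x n := by
    obtain ⟨m, hm, -⟩ := Plane.exists_unit_normal 0
    have := hΩ.isOutwardNormal_of_frontier_subset_line hx hm (by
      filter_upwards [hev] with y hy hyfr
      rw [hy.resolve_right (hfr y hyfr)]
      simp)
    exact this.elim (fun h => ⟨_, h⟩) fun h => ⟨_, h⟩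
  obtain ⟨n, hn⟩ := hn
  have hlim := IsOutwardNormal.tendsto_add_smul x n
  obtain ⟨t, ⟨h1, h2⟩, ht⟩ :=
    ((hlim.eventually (hev.and hn.eventually_mem_iff)).and self_mem_nhdsWithin).exists
  replace ht : 0 < t := ht
  rw [h2, add_sub_cancel_left, inner_smul_left, hn.inner_self] at h1
  rcases h1 with h1 | h1
  · rw [add_eq_left, smul_eq_zero] at h1
    rcases h1 with h1 | h1
    · exact ht.ne' h1
    · have := hn.1
      rw [h1, norm_zero] at this
      exact zero_ne_one this
  · simp only [RCLike.conj_to_real, mul_one] at h1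
    exact ht.not_gt h1

theorem isSlidingMap_of_tangentialC1 {Ω : Set Plane} (hΩ : IsRegularPolytope Ω)
    {φ Φ : Plane → Plane} (hφ : φ ∈ tangentialC1 Ω) (hΦ : ∀ x, Φ x = x + φ x)
    (hJ : ∀ x ∈ closure Ω, 0 < jacobianDet Ω Φ x) : IsSlidingMap Ω Φ := by
  obtain ⟨⟨hcont, hdiff, hlim⟩, htan⟩ := hφ
  obtain rfl : Φ = fun x => x + φ x := funext hΦ
  have hφd : DifferentiableOn ℝ φ Ω := hdiff.differentiableOn one_ne_zero
  obtain ⟨V, -, hV⟩ := hΩ.exists_finite_vertices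
  refine ⟨hΩ.isOpen, hΩ.isBounded, continuousOn_id.add hcont, differentiableOn_id.add hφd, ?_, ?_, ?_⟩
  · intro x hx
    obtain ⟨L, hL⟩ := hlim x hx
    have hT : Tendsto (fderiv ℝ fun x => x + φ x) (𝓝[Ω] x)
        (𝓝 (ContinuousLinearMap.id ℝ Plane + L)) := by
      refine (tendsto_const_nhds.add hL).congr' ?_
      filter_upwards [self_mem_nhdsWithin] with y hy
      have hd := (hφd y hy).differentiableAt (hΩ.isOpen.mem_nhds hy)
      exact ((hasFDerivAt_id y).add hd.hasFDerivAt).fderiv.symm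
    refine ⟨_, hT, ?_⟩
    have := hJ x hx
    rwa [jacobianDet, extendFrom_eq hx hT] at this
  · intro x n hn
    rw [add_sub_cancel_left]
    exact htan x hn.mem_frontier n hn
  · intro x hx hno
    rw [((hV x hx).resolve_left hno).2 φ hcont htan, add_zero]

theorem mainTheorem1 (Ω : Set Plane) (hΩ : IsRegularPolytope Ω)
    (φ : Plane → Plane) (hφ : φ ∈ tangentialC1 Ω)
    (Φ : Plane → Plane) (hΦ : ∀ x, Φ x = x + φ x)
    (hJ : ∀ x ∈ closure Ω, 0 < jacobianDet Ω Φ x) :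
    Set.BijOn Φ Ω Ω := by
  obtain ⟨V, hVfin, hV⟩ := hΩ.exists_finite_vertices
  exact (isSlidingMap_of_tangentialC1 hΩ hφ hΦ hJ).bijOn
    (hVfin.subset fun x hx => ((hV x hx.1).resolve_left hx.2).1)
    fun x hx => hΩ.not_eventually_eq_or_mem hx
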